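/- Let $m,\hbar,c>0$ and $q,B\in\mathbb R$. Let $a,b\in\mathbb R^2$ with $a_1b_2-a_2b_1>0$, let $\Gamma=\{n_1a+n_2b: n_1,n_2\in\mathbb Z\}$ and $M_\Gamma=\{l_1a+l_2b: l_1,l_2\in[0,1]\}$. For $n\in\mathbb N\cup\{\infty\}$ let $C^n_{\mathrm b}(\mathbb R^2,\mathbb R)$ be the space of real functions of class $C^n$ whose derivatives of all orders $\le n$ (order $0$ included) are bounded. Assume: * ($\mathrm A_{\mathrm w}$) $A_\Gamma:\mathbb R^2\to\mathbb R^2$ and $V_\Gamma:\mathbb R^2\to\mathbb R$ are $\Gamma$-periodic, the components of $A_\Gamma$ are in $C^1_{\mathrm b}(\mathbb R^2,\mathbb R)$, and $\int_{M_\Gamma}|V_\Gamma(r)|^2\,d^2r<\infty$; * ($\mathrm B$) $\Phi\in C^\infty_{\mathrm b}(\mathbb R^2,\mathbb R)$, and $A=A_0+A_B$, where the components of $A_0$ are in $C^\infty_{\mathrm b}(\mathbb R^2,\mathbb R)$ and $A_B(r)=\left(-\tfrac B2 r_2,\tfrac B2 r_1\right)$. Consider in $L^2(\mathbb R^2)$,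 on the domain $C^\infty_{\mathrm c}(\mathbb R^2,\mathbb C)$, the Bloch–Landau Hamiltonian $$H_{\mathrm{BL}}=\frac1{2m}\Big[-i\hbar\nabla-\frac qcA_\Gamma-\frac qcA\Big]^2+V_\Gamma+q\,\Phi$$ and the periodic Hamiltonian $$H_{\mathrm{per}}=\frac1{2m}\Big[-i\hbar\nabla-\frac qcA_\Gamma\Big]^2+V_\Gamma .$$ Then $H_{\mathrm{BL}}$ and $H_{\mathrm{per}}$ are both essentially self-adjoint on $C^\infty_{\mathrm c}(\mathbb R^2,\mathbb C)$. The domain of the (self-adjoint) closure of $H_{\mathrm{per}}$ is the Sobolev space $$H^2(\mathbb R^2)=\{\psi\in L^2(\mathbb R^2):\ \partial_1^{n_1}\partial_2^{n_2}\psi\in L^2(\mathbb R^2)\text{ for all } n_1,n_2\in\mathbb N,\ n_1+n_2\le2\},$$ and the domain of the closure of $H_{\mathrm{BL}}$ is the magnetic Sobolev space $$H^2_{\mathrm M}(\mathbb R^2)=\{\psi\in L^2(\mathbb R^2):\ D_1^{n_1}D_2^{n_2}\psi\in L^2(\mathbb R^2)\text{ for all } n_1,n_2\in\mathbb N,\ n_1+n_2\le2\},$$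 with derivatives in the sense of distributions, where $D_1=\partial_1+\tfrac{i\beta}2r_2$, $D_2=\partial_2-\tfrac{i\beta}2r_1$ and $\beta=\dfrac{qB}{c\hbar}$. -/

import Mathlib

open MeasureTheory
open scoped ContDiff SchwartzMap LineDeriv

namespace BlochLandau

/-- The plane `ℝ²` with its Euclidean structure and Lebesgue measure. -/
abbrev Plane : Type := EuclideanSpace ℝ (Fin 2)

/-- The Hilbert space `L²(ℝ², ℂ)`. -/
abbrev L2 : Type := Lp ℂ 2 (volume : Measure Plane)

/-- The standard basis vector `e_j` of `ℝ²`. -/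
noncomputable abbrev e (j : Fin 2) : Plane := EuclideanSpace.single j (1 : ℝ)

/-! ### Lattices and periodic functions -/

/-- The lattice vector `n₁ a + n₂ b`. -/
def latticeVec (a b : Plane) (n : ℤ × ℤ) : Plane := n.1 • a + n.2 • b

/-- `f` is periodic with respect to the lattice generated by `a` and `b`. -/
def IsLatticePeriodic {α : Type*} (a b : Plane) (f : Plane → α) : Prop :=
  ∀ (n : ℤ × ℤ) (r : Plane), f (r + latticeVec a b n) = f r

/-- The fundamental cell `{l₁ a + l₂ b : l₁, l₂ ∈ [0, 1]}`. -/
def cell (a b : Plane) : Set Plane :=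
  {r | ∃ l₁ ∈ Set.Icc (0 : ℝ) 1, ∃ l₂ ∈ Set.Icc (0 : ℝ) 1, r = l₁ • a + l₂ • b}

/-- The oriented area `a ∧ b = a₁ b₂ - a₂ b₁`. -/
def wedge (a b : Plane) : ℝ := a 0 * b 1 - a 1 * b 0

/-! ### Assumptions on the potentials -/

/-- The class `C^n_b(ℝ², ℝ)`: real functions of class `C^n` whose derivatives of every order up to
`n` (order zero included) are bounded. -/
def IsCb (n : ℕ∞) (f : Plane → ℝ) : Prop :=
  ContDiff ℝ n f ∧ ∀ k : ℕ, (k : ℕ∞) ≤ n → ∃ C : ℝ, ∀ x, ‖iteratedFDeriv ℝ k f x‖ ≤ C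

/-- Internal potentials, weak form: `A_Γ` and `V_Γ` are periodic, the components of `A_Γ` are of
class `C^1_b`, and `V_Γ` is square integrable over the fundamental cell. -/
structure InternalWeak (a b : Plane) (AΓ : Plane → Plane) (VΓ : Plane → ℝ) : Prop where
  periodic_A : IsLatticePeriodic a b AΓ
  periodic_V : IsLatticePeriodic a b VΓ
  cb_A : ∀ j, IsCb 1 (fun r => AΓ r j)
  memLp_V : MemLp VΓ 2 (volume.restrict (cell a b))

/-- External potentials: `Φ` and the components of `A₀` are of class `C^∞_b`. -/
structure External (A₀ : Plane → Plane) (Φ : Plane → ℝ) : Prop where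
  cb_A : ∀ j, IsCb ⊤ (fun r => A₀ r j)
  cb_Φ : IsCb ⊤ Φ

/-- The vector potential `A_B(r) = (-B r₂ / 2, B r₁ / 2)` of a uniform magnetic field, in the
symmetric gauge. -/
noncomputable def uniformPotential (B : ℝ) (r : Plane) : Plane :=
  !₂[-(B / 2) * r 1, B / 2 * r 0]

/-! ### Schrödinger operators on smooth compactly supported functions -/

/-- The space `C^∞_c(ℝ², ℂ)`. -/
def testFunctions : Submodule ℂ (Plane → ℂ) where
  carrier := {φ | ContDiff ℝ ∞ φ ∧ HasCompactSupport φ}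
  zero_mem' := ⟨contDiff_const, HasCompactSupport.zero⟩
  add_mem' h h' := ⟨h.1.add h'.1, h.2.add h'.2⟩
  smul_mem' c _ h := ⟨contDiff_const.smul h.1, h.2.smul_left (f := fun _ => c)⟩

/-- The `j`-th component of `-i ħ ∇ - κ A`, acting on functions. -/
noncomputable def momentum (ħ κ : ℝ) (A : Plane → Plane) (j : Fin 2) (φ : Plane → ℂ) :
    Plane → ℂ :=
  fun r => -Complex.I * (ħ : ℂ) * fderiv ℝ φ r (e j) - (κ : ℂ) * (A r j : ℂ) * φ r

/-- The differential expression `(1 / 2m) (-i ħ ∇ - κ A)² φ + V φ`. -/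
noncomputable def hamiltonianExpr (m ħ κ : ℝ) (A : Plane → Plane) (V : Plane → ℝ)
    (φ : Plane → ℂ) : Plane → ℂ :=
  fun r => (1 / (2 * (m : ℂ))) * ∑ j, momentum ħ κ A j (momentum ħ κ A j φ) r + (V r : ℂ) * φ r

/-- `V` is locally square integrable. -/
def IsLocallyL2 (V : Plane → ℝ) : Prop :=
  ∀ K : Set Plane, IsCompact K → MemLp V 2 (volume.restrict K)

lemma momentum_contDiff {n k : ℕ∞} (hk : k + 1 ≤ n) {ħ κ : ℝ} {A : Plane → Plane} {j : Fin 2}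
    (hA : ContDiff ℝ k (fun r => A r j)) {φ : Plane → ℂ} (hφ : ContDiff ℝ n φ) :
    ContDiff ℝ k (momentum ħ κ A j φ) := by
  have h1 : ContDiff ℝ k (fderiv ℝ φ) := hφ.fderiv_right (by exact_mod_cast hk)
  have h2 : ContDiff ℝ k φ := hφ.of_le (by exact_mod_cast le_trans le_self_add hk)
  have h3 : ContDiff ℝ k (fun r => (A r j : ℂ)) := Complex.ofRealCLM.contDiff.comp hA
  unfold momentum
  exact (contDiff_const.mul (h1.clm_apply contDiff_const)).sub ((contDiff_const.mul h3).mul h2)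

lemma momentum_hasCompactSupport {ħ κ : ℝ} {A : Plane → Plane} {j : Fin 2} {φ : Plane → ℂ}
    (hφ : HasCompactSupport φ) : HasCompactSupport (momentum ħ κ A j φ) := by
  have h1 : HasCompactSupport (fun r => fderiv ℝ φ r (e j)) := hφ.fderiv_apply (𝕜 := ℝ) (e j)
  exact (h1.mul_left (f := fun _ => -Complex.I * (ħ : ℂ))).sub
    (hφ.mul_left (f := fun r => (κ : ℂ) * (A r j : ℂ)))

lemma momentum_add {ħ κ : ℝ} {A : Plane → Plane} {j : Fin 2} {φ ψ : Plane → ℂ}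
    (hφ : Differentiable ℝ φ) (hψ : Differentiable ℝ ψ) :
    momentum ħ κ A j (φ + ψ) = momentum ħ κ A j φ + momentum ħ κ A j ψ := by
  funext r
  simp only [momentum, Pi.add_apply, fderiv_add (hφ r) (hψ r), add_apply]
  ring

lemma momentum_smul {ħ κ : ℝ} {A : Plane → Plane} {j : Fin 2} (c : ℂ) {φ : Plane → ℂ}
    (hφ : Differentiable ℝ φ) :
    momentum ħ κ A j (c • φ) = c • momentum ħ κ A j φ := by
  funext r
  have h : fderiv ℝ (c • φ) r = c • fderiv ℝ φ r := fderiv_const_smul (hφ r) c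
  simp only [momentum, Pi.smul_apply, h, smul_apply, smul_eq_mul]
  ring

section Expression

variable {m ħ κ : ℝ} {A : Plane → Plane} {V : Plane → ℝ}

lemma momentum_differentiable (hA : ∀ j, ContDiff ℝ 1 (fun r => A r j)) {φ : Plane → ℂ}
    (hφ : ContDiff ℝ ∞ φ) (j : Fin 2) : Differentiable ℝ (momentum ħ κ A j φ) := by
  have h : ContDiff ℝ ((1 : ℕ∞) : WithTop ℕ∞) (momentum ħ κ A j φ) :=
    momentum_contDiff (n := ⊤) le_top (by exact_mod_cast hA j) hφ
  exact h.differentiable (by simp)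

lemma hamiltonianExpr_add (hA : ∀ j, ContDiff ℝ 1 (fun r => A r j)) {φ ψ : Plane → ℂ}
    (hφ : ContDiff ℝ ∞ φ) (hψ : ContDiff ℝ ∞ ψ) :
    hamiltonianExpr m ħ κ A V (φ + ψ) =
      hamiltonianExpr m ħ κ A V φ + hamiltonianExpr m ħ κ A V ψ := by
  funext r
  have h (j : Fin 2) := momentum_add (ħ := ħ) (κ := κ) (A := A) (j := j)
    (hφ.differentiable (by simp)) (hψ.differentiable (by simp))
  have h' (j : Fin 2) := momentum_add (ħ := ħ) (κ := κ) (A := A) (j := j)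
    (momentum_differentiable (ħ := ħ) (κ := κ) hA hφ j)
    (momentum_differentiable (ħ := ħ) (κ := κ) hA hψ j)
  simp only [hamiltonianExpr, h, h', Pi.add_apply, Finset.sum_add_distrib]
  ring

lemma hamiltonianExpr_smul (hA : ∀ j, ContDiff ℝ 1 (fun r => A r j)) (c : ℂ) {φ : Plane → ℂ}
    (hφ : ContDiff ℝ ∞ φ) :
    hamiltonianExpr m ħ κ A V (c • φ) = c • hamiltonianExpr m ħ κ A V φ := by
  funext r
  have h (j : Fin 2) := momentum_smul (ħ := ħ) (κ := κ) (A := A) (j := j) c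
    (hφ.differentiable (by simp))
  have h' (j : Fin 2) := momentum_smul (ħ := ħ) (κ := κ) (A := A) (j := j) c
    (momentum_differentiable (ħ := ħ) (κ := κ) hA hφ j)
  simp only [hamiltonianExpr, h, h', Pi.smul_apply, smul_eq_mul, ← Finset.mul_sum]
  ring

lemma memLp_potential_mul (hV : IsLocallyL2 V) {φ : Plane → ℂ} (hφ : Continuous φ)
    (hc : HasCompactSupport φ) : MemLp (fun r => (V r : ℂ) * φ r) 2 (volume : Measure Plane) := by
  have hV' : MemLp (fun r => (V r : ℂ)) 2 (volume.restrict (tsupport φ)) :=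
    (hV _ hc).ofReal
  have hφ' : MemLp φ ⊤ (volume.restrict (tsupport φ)) :=
    (hφ.memLp_top_of_hasCompactSupport hc volume).restrict _
  have h : MemLp (fun r => (V r : ℂ) * φ r) 2 (volume.restrict (tsupport φ)) := hφ'.mul hV'
  have h2 := (memLp_indicator_iff_restrict (isClosed_tsupport φ).measurableSet).2 h
  rwa [Set.indicator_eq_self.2] at h2
  intro r hr
  refine subset_tsupport φ fun h0 => hr ?_
  simp [h0]

lemma memLp_hamiltonianExpr (hA : ∀ j, ContDiff ℝ 1 (fun r => A r j)) (hV : IsLocallyL2 V)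
    {φ : Plane → ℂ} (hφ : φ ∈ testFunctions) :
    MemLp (hamiltonianExpr m ħ κ A V φ) 2 (volume : Measure Plane) := by
  have h (j : Fin 2) : MemLp (momentum ħ κ A j (momentum ħ κ A j φ)) 2
      (volume : Measure Plane) := by
    have h1 : ContDiff ℝ ((1 : ℕ∞) : WithTop ℕ∞) (momentum ħ κ A j φ) :=
      momentum_contDiff (n := ⊤) le_top (by exact_mod_cast hA j) hφ.1
    have h2 : ContDiff ℝ ((0 : ℕ∞) : WithTop ℕ∞) (momentum ħ κ A j (momentum ħ κ A j φ)) :=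
      momentum_contDiff (by simp) ((hA j).of_le (by simp)) h1
    exact h2.continuous.memLp_of_hasCompactSupport
      (momentum_hasCompactSupport (momentum_hasCompactSupport hφ.2))
  have hs := (memLp_finsetSum Finset.univ fun j _ => h j).const_mul (1 / (2 * (m : ℂ)))
  exact hs.add (memLp_potential_mul hV hφ.1.continuous hφ.2)

end Expression

/-- The inclusion of `C^∞_c(ℝ², ℂ)` in `L²(ℝ², ℂ)`. -/
noncomputable def testToL2 : testFunctions →ₗ[ℂ] L2 where
  toFun φ := (φ.2.1.continuous.memLp_of_hasCompactSupport (p := 2) (μ := volume) φ.2.2).toLp φ.1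
  map_add' _ _ := rfl
  map_smul' _ _ := rfl

lemma testToL2_injective : Function.Injective testToL2 := by
  intro φ ψ h
  have h1 : φ.1 =ᵐ[volume] ψ.1 := (MemLp.toLp_eq_toLp_iff
    (φ.2.1.continuous.memLp_of_hasCompactSupport (p := 2) φ.2.2)
    (ψ.2.1.continuous.memLp_of_hasCompactSupport (p := 2) ψ.2.2)).1 h
  exact Subtype.ext ((Continuous.ae_eq_iff_eq volume φ.2.1.continuous ψ.2.1.continuous).1 h1)

/-- The map sending `φ` in `C^∞_c(ℝ², ℂ)` to the class of `(1 / 2m) (-i ħ ∇ - κ A)² φ + V φ`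
in `L²(ℝ², ℂ)`. -/
noncomputable def hamiltonianOnTest (m ħ κ : ℝ) (A : Plane → Plane) (V : Plane → ℝ)
    (hA : ∀ j, ContDiff ℝ 1 (fun r => A r j)) (hV : IsLocallyL2 V) : testFunctions →ₗ[ℂ] L2 where
  toFun φ := (memLp_hamiltonianExpr (m := m) (ħ := ħ) (κ := κ) hA hV φ.2).toLp _
  map_add' φ ψ := by
    rw [← MemLp.toLp_add]
    exact MemLp.toLp_congr _ _ (by
      rw [Submodule.coe_add, hamiltonianExpr_add hA φ.2.1 ψ.2.1])
  map_smul' c φ := by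
    rw [RingHom.id_apply, ← MemLp.toLp_const_smul]
    exact MemLp.toLp_congr _ _ (by
      rw [Submodule.coe_smul, hamiltonianExpr_smul hA c φ.2.1])

/-- The operator `(1 / 2m) (-i ħ ∇ - κ A)² + V` in `L²(ℝ², ℂ)` with domain `C^∞_c(ℝ², ℂ)`. -/
noncomputable def schrodinger (m ħ κ : ℝ) (A : Plane → Plane) (V : Plane → ℝ)
    (hA : ∀ j, ContDiff ℝ 1 (fun r => A r j)) (hV : IsLocallyL2 V) : L2 →ₗ.[ℂ] L2 where
  domain := LinearMap.range testToL2
  toFun := hamiltonianOnTest m ħ κ A V hA hV ∘ₗ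
    (LinearEquiv.ofInjective testToL2 testToL2_injective).symm.toLinearMap

/-- The defining property of `schrodinger`. -/
lemma schrodinger_apply (m ħ κ : ℝ) (A : Plane → Plane) (V : Plane → ℝ)
    (hA : ∀ j, ContDiff ℝ 1 (fun r => A r j)) (hV : IsLocallyL2 V) (φ : testFunctions) :
    schrodinger m ħ κ A V hA hV ⟨testToL2 φ, φ, rfl⟩ =
      (memLp_hamiltonianExpr (m := m) (ħ := ħ) (κ := κ) hA hV φ.2).toLp _ := by
  have : (LinearEquiv.ofInjective testToL2 testToL2_injective).symm ⟨testToL2 φ, φ, rfl⟩ = φ := by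
    rw [LinearEquiv.symm_apply_eq]; rfl
  change hamiltonianOnTest m ħ κ A V hA hV
    ((LinearEquiv.ofInjective testToL2 testToL2_injective).symm ⟨testToL2 φ, φ, rfl⟩) = _
  rw [this]; rfl

/-! ### The Bloch and Bloch–Landau Hamiltonians -/

section Periodic

variable {a b : Plane}

lemma exists_mem_cell (hab : 0 < wedge a b) (r : Plane) :
    r - latticeVec a b (⌊(r 0 * b 1 - r 1 * b 0) / wedge a b⌋,
      ⌊(a 0 * r 1 - a 1 * r 0) / wedge a b⌋) ∈ cell a b := by
  refine ⟨Int.fract ((r 0 * b 1 - r 1 * b 0) / wedge a b),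
    ⟨Int.fract_nonneg _, (Int.fract_lt_one _).le⟩,
    Int.fract ((a 0 * r 1 - a 1 * r 0) / wedge a b),
    ⟨Int.fract_nonneg _, (Int.fract_lt_one _).le⟩, ?_⟩
  have h : r = ((r 0 * b 1 - r 1 * b 0) / wedge a b) • a +
      ((a 0 * r 1 - a 1 * r 0) / wedge a b) • b := by
    have h0 := hab.ne'
    ext j
    fin_cases j <;> simp <;> field_simp <;> simp [wedge] <;> ring
  generalize (r 0 * b 1 - r 1 * b 0) / wedge a b = s at *
  generalize (a 0 * r 1 - a 1 * r 0) / wedge a b = t at *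
  simp only [latticeVec, Int.fract, sub_smul, Int.cast_smul_eq_zsmul]
  rw [h]
  abel

lemma measurableSet_cell : MeasurableSet (cell a b) := by
  have h : cell a b =
      (fun l : ℝ × ℝ => l.1 • a + l.2 • b) '' (Set.Icc (0 : ℝ) 1 ×ˢ Set.Icc (0 : ℝ) 1) := by
    ext r
    constructor
    · rintro ⟨l₁, h₁, l₂, h₂, rfl⟩
      exact ⟨(l₁, l₂), ⟨h₁, h₂⟩, rfl⟩
    · rintro ⟨⟨l₁, l₂⟩, ⟨h₁, h₂⟩, rfl⟩
      exact ⟨l₁, h₁, l₂, h₂, rfl⟩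
  rw [h]
  exact ((isCompact_Icc.prod isCompact_Icc).image (by fun_prop)).measurableSet

/-- The translate of the fundamental cell by a lattice vector. -/
def cellAt (a b : Plane) (n : ℤ × ℤ) : Set Plane := (fun r => r - latticeVec a b n) ⁻¹' cell a b

lemma memLp_cellAt {V : Plane → ℝ} (hp : IsLatticePeriodic a b V)
    (hV : MemLp V 2 (volume.restrict (cell a b))) (n : ℤ × ℤ) :
    MemLp V 2 (volume.restrict (cellAt a b n)) := by
  have h := (measurePreserving_sub_right (volume : Measure Plane)
    (latticeVec a b n)).restrict_preimage (measurableSet_cell (a := a) (b := b))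
  have h2 := hV.comp_measurePreserving h
  change MemLp V 2 (volume.restrict ((fun r => r - latticeVec a b n) ⁻¹' cell a b))
  convert h2 using 1
  funext r
  have := hp n (r - latticeVec a b n)
  rw [sub_add_cancel] at this
  exact this

lemma isLocallyL2_of_periodic (hab : 0 < wedge a b) {V : Plane → ℝ}
    (hp : IsLatticePeriodic a b V) (hV : MemLp V 2 (volume.restrict (cell a b))) :
    IsLocallyL2 V := by
  intro K hK
  obtain ⟨C₁, h₁⟩ := hK.exists_bound_of_continuousOn
    (f := fun r : Plane => (r 0 * b 1 - r 1 * b 0) / wedge a b) (by fun_prop)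
  obtain ⟨C₂, h₂⟩ := hK.exists_bound_of_continuousOn
    (f := fun r : Plane => (a 0 * r 1 - a 1 * r 0) / wedge a b) (by fun_prop)
  let s : Finset (ℤ × ℤ) := Finset.Icc ⌊-C₁⌋ ⌊C₁⌋ ×ˢ Finset.Icc ⌊-C₂⌋ ⌊C₂⌋
  have hsub : K ⊆ ⋃ n ∈ s, cellAt a b n := by
    intro r hr
    have e₁ := abs_le.1 (h₁ r hr)
    have e₂ := abs_le.1 (h₂ r hr)
    refine Set.mem_biUnion (x := (⌊(r 0 * b 1 - r 1 * b 0) / wedge a b⌋,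
      ⌊(a 0 * r 1 - a 1 * r 0) / wedge a b⌋)) ?_ (exists_mem_cell hab r)
    simp only [s, Finset.coe_product, Set.mem_prod, Finset.coe_Icc, Set.mem_Icc]
    exact ⟨⟨Int.floor_le_floor e₁.1, Int.floor_le_floor e₁.2⟩,
      Int.floor_le_floor e₂.1, Int.floor_le_floor e₂.2⟩
  refine MemLp.mono_measure (Measure.restrict_mono hsub le_rfl) ?_
  have hm : AEStronglyMeasurable V (volume.restrict (⋃ n ∈ s, cellAt a b n)) := by
    have h : AEStronglyMeasurable V (volume.restrict (⋃ n, cellAt a b n)) :=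
      AEStronglyMeasurable.iUnion fun n => (memLp_cellAt hp hV n).1
    exact h.mono_measure (Measure.restrict_mono (Set.iUnion₂_subset_iUnion _ _) le_rfl)
  rw [memLp_two_iff_integrable_sq hm]
  exact integrableOn_finset_iUnion.2 fun n _ => (memLp_cellAt hp hV n).integrable_sq

end Periodic

lemma IsLocallyL2.add {V W : Plane → ℝ} (hV : IsLocallyL2 V) (hW : IsLocallyL2 W) :
    IsLocallyL2 (fun r => V r + W r) := fun K hK => (hV K hK).add (hW K hK)

lemma isLocallyL2_of_continuous {W : Plane → ℝ} (hW : Continuous W) : IsLocallyL2 W := by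
  intro K hK
  have : IsFiniteMeasure (volume.restrict K) := ⟨by simpa using hK.measure_lt_top⟩
  obtain ⟨C, hC⟩ := hK.exists_bound_of_continuousOn hW.continuousOn
  exact MemLp.of_bound hW.aestronglyMeasurable C
    ((ae_restrict_iff' hK.measurableSet).2 (Filter.Eventually.of_forall hC))

lemma contDiff_total {a b : Plane} {AΓ A₀ : Plane → Plane} {VΓ Φ : Plane → ℝ} (B : ℝ)
    (hΓ : InternalWeak a b AΓ VΓ) (hE : External A₀ Φ) (j : Fin 2) :
    ContDiff ℝ 1 (fun r => (AΓ r + (A₀ r + uniformPotential B r)) j) := by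
  have h1 : ContDiff ℝ 1 (fun r => AΓ r j) := by exact_mod_cast (hΓ.cb_A j).1
  have h2 : ContDiff ℝ 1 (fun r => A₀ r j) := (hE.cb_A j).1.of_le (by exact_mod_cast le_top)
  have h3 : ContDiff ℝ 1 (fun r => uniformPotential B r j) := by
    fin_cases j <;> simp [uniformPotential] <;> fun_prop
  exact h1.add (h2.add h3)

/-- The periodic (Bloch) Hamiltonian `(1 / 2m) (-i ħ ∇ - (q / c) A_Γ)² + V_Γ`
with domain `C^∞_c(ℝ², ℂ)`. -/
noncomputable def periodicHamiltonian (m ħ q c : ℝ) {a b : Plane} (hab : 0 < wedge a b)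
    {AΓ : Plane → Plane} {VΓ : Plane → ℝ} (hΓ : InternalWeak a b AΓ VΓ) : L2 →ₗ.[ℂ] L2 :=
  schrodinger m ħ (q / c) AΓ VΓ (fun j => by exact_mod_cast (hΓ.cb_A j).1)
    (isLocallyL2_of_periodic hab hΓ.periodic_V hΓ.memLp_V)

/-- The Bloch–Landau Hamiltonian
`(1 / 2m) (-i ħ ∇ - (q / c) A_Γ - (q / c) (A₀ + A_B))² + V_Γ + q Φ`
with domain `C^∞_c(ℝ², ℂ)`. -/
noncomputable def blochLandauHamiltonian (m ħ q c B : ℝ) {a b : Plane} (hab : 0 < wedge a b)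
    {AΓ A₀ : Plane → Plane} {VΓ Φ : Plane → ℝ} (hΓ : InternalWeak a b AΓ VΓ)
    (hE : External A₀ Φ) : L2 →ₗ.[ℂ] L2 :=
  schrodinger m ħ (q / c) (fun r => AΓ r + (A₀ r + uniformPotential B r))
    (fun r => VΓ r + q * Φ r) (contDiff_total B hΓ hE)
    ((isLocallyL2_of_periodic hab hΓ.periodic_V hΓ.memLp_V).add
      (isLocallyL2_of_continuous (continuous_const.mul hE.cb_Φ.1.continuous)))

/-- A (densely defined) operator is essentially self-adjoint if it is closable and its closure is
self-adjoint. Density of the domain is part of self-adjointness of the closure. -/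
def IsEssentiallySelfAdjoint (T : L2 →ₗ.[ℂ] L2) : Prop :=
  T.IsClosable ∧ IsSelfAdjoint T.closure

/-! ### Sobolev spaces -/

/-- The distributional partial derivative `∂_j`. -/
noncomputable def partialD (j : Fin 2) : 𝓢'(Plane, ℂ) →L[ℂ] 𝓢'(Plane, ℂ) :=
  LineDeriv.lineDerivOpCLM ℂ 𝓢'(Plane, ℂ) (e j)

/-- The covariant derivatives `D_j = ∂_j - i (A_β)_j` on tempered distributions, where `A_β` is the
symmetric-gauge potential of strength `β`; thus `D_1 = ∂_1 + (i β / 2) x_2` and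
`D_2 = ∂_2 - (i β / 2) x_1`. -/
noncomputable def magneticD (β : ℝ) (j : Fin 2) : 𝓢'(Plane, ℂ) →L[ℂ] 𝓢'(Plane, ℂ) :=
  partialD j -
    TemperedDistribution.smulLeftCLM ℂ (fun x => Complex.I * (uniformPotential β x j : ℂ))

/-- The `ψ ∈ L²` such that the distribution `P₁^{n₁} P₂^{n₂} ψ` is in `L²` whenever
`n₁ + n₂ ≤ 2`. -/
noncomputable def sobolevOf (P : Fin 2 → 𝓢'(Plane, ℂ) →L[ℂ] 𝓢'(Plane, ℂ)) : Submodule ℂ L2 where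
  carrier := {ψ | ∀ n₁ n₂ : ℕ, n₁ + n₂ ≤ 2 →
    ∃ g : L2, (P 0 ^ n₁ * P 1 ^ n₂) (ψ : 𝓢'(Plane, ℂ)) = (g : 𝓢'(Plane, ℂ))}
  zero_mem' n₁ n₂ _ := ⟨0, by
    have h := map_zero (Lp.toTemperedDistributionCLM ℂ (volume : Measure Plane) 2)
    rw [Lp.toTemperedDistributionCLM_apply] at h
    rw [h, map_zero]⟩
  add_mem' {ψ χ} hψ hχ n₁ n₂ hn := by
    obtain ⟨g, hg⟩ := hψ n₁ n₂ hn
    obtain ⟨g', hg'⟩ := hχ n₁ n₂ hn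
    refine ⟨g + g', ?_⟩
    have h := map_add (Lp.toTemperedDistributionCLM ℂ (volume : Measure Plane) 2)
    simp only [Lp.toTemperedDistributionCLM_apply] at h
    rw [h, h, map_add, hg, hg']
  smul_mem' c ψ hψ n₁ n₂ hn := by
    obtain ⟨g, hg⟩ := hψ n₁ n₂ hn
    refine ⟨c • g, ?_⟩
    have h := map_smul (Lp.toTemperedDistributionCLM ℂ (volume : Measure Plane) 2)
    simp only [Lp.toTemperedDistributionCLM_apply] at h
    rw [h, h, map_smul, hg]

/-- The second Sobolev space `H²(ℝ²)`. -/
noncomputable def sobolevTwo : Submodule ℂ L2 := sobolevOf partialD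

/-- The second magnetic Sobolev space `H²_M(ℝ²)` for a uniform field of strength `β`. -/
noncomputable def magneticSobolevTwo (β : ℝ) : Submodule ℂ L2 := sobolevOf (magneticD β)

end BlochLandau

/-! Both operators are treated as perturbations of the same kind of model operator, the covariant
Laplacian `L = P₀² + P₁²` with `P_j = -i ∂_j - (A_β)_j`, where `β = qB/(cħ)` for the Bloch–Landau
Hamiltonian and `β = 0` for the periodic one. All estimates are made on test functions, with `β` as
a parameter.

Model operator. For `l > 0` the range of `L + l` is dense
(`eq_zero_of_inner_covLaplacian_add_eq_zero`). If `u` is orthogonal to it, pair `u` with the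
reflected magnetic translates of a test function. This gives a bounded function `v` with `∑ (-i ∂_j
+ (A_β)_j)² v = -l v`, hence `Δ|v|² ≥ 2l|v|²`. The maximum principle forces `v = 0`, and `v(0)` runs
over all pairings of `u` with test functions.

Perturbation. Up to the factor `ħ²/2m`, the Hamiltonian differs from `L` by first-order terms with
bounded coefficients and by a uniformly locally square integrable potential. Its bound relative to
`L` is zero (`exists_relative_bound`). First derivatives are controlled by `⟨Lφ, φ⟩ = ∑ ‖P_j φ‖²`.
The potential is controlled by a Sobolev inequality on unit squares that involves only `φ`, `P_j φ`
and `P₁P₀φ`, with an arbitrarily small weight on the last. The commutator `[P₀, P₁] = iβ` lets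
`‖Lφ‖` and `‖φ‖` dominate all second derivatives (`norm_sq_covLaplacian`).

Self-adjointness. Kato–Rellich transfers density of the range to the full operator. A symmetric
operator whose shift by `l` is bounded below with dense range has a self-adjoint closure
(`HasGraph.essentiallySelfAdjoint`).

Domain. The graph norms of the Hamiltonian and of `L` are equivalent, so their closures have the
same domain. For `L` this is the magnetic Sobolev space (`mem_magneticSobolevTwo_iff`): limits in
graph norm have distributional derivatives in `L²` because `D_j = i P_j` is a continuous operator on
distributions, and conversely a Sobolev function lies in the domain of `L* = L̄`. -/

namespace BlochLandau

/-! ### Abstract criteria for essential self-adjointness -/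

section Abstract

open Filter Topology

variable {H D : Type*} [NormedAddCommGroup H] [InnerProductSpace ℂ H]
  [AddCommGroup D] [Module ℂ D]

/-- The graph of `T` is the range of `φ ↦ (J φ, K φ)`. -/
def HasGraph (T : H →ₗ.[ℂ] H) (J K : D →ₗ[ℂ] H) : Prop :=
  ∀ p : H × H, p ∈ T.graph ↔ ∃ φ, (J φ, K φ) = p

variable {T : H →ₗ.[ℂ] H} {J K : D →ₗ[ℂ] H}

lemma HasGraph.dense_domain (hT : HasGraph T J K) (hJ : DenseRange J) :
    Dense (T.domain : Set H) := by
  refine Dense.mono ?_ hJ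
  rintro _ ⟨φ, rfl⟩
  exact LinearPMap.mem_domain_iff.2 ⟨K φ, (hT _).2 ⟨φ, rfl⟩⟩

lemma HasGraph.mem_closure_graph_iff (hT : HasGraph T J K) (hc : T.IsClosable) {x y : H} :
    (x, y) ∈ T.closure.graph ↔ ∃ φ : ℕ → D, Tendsto (fun n => J (φ n)) atTop (𝓝 x) ∧
      Tendsto (fun n => K (φ n)) atTop (𝓝 y) := by
  rw [← hc.graph_closure_eq_closure_graph, ← SetLike.mem_coe, Submodule.topologicalClosure_coe,
    mem_closure_iff_seq_limit]
  constructor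
  · rintro ⟨p, hp, hlim⟩
    choose φ hφ using fun n => (hT (p n)).1 (hp n)
    refine ⟨φ, ?_, ?_⟩
    · have := (continuous_fst.tendsto _).comp hlim
      refine this.congr fun n => ?_
      simp [← hφ n]
    · have := (continuous_snd.tendsto _).comp hlim
      refine this.congr fun n => ?_
      simp [← hφ n]
  · rintro ⟨φ, h1, h2⟩
    exact ⟨fun n => (J (φ n), K (φ n)), fun n => (hT _).2 ⟨φ n, rfl⟩, h1.prodMk_nhds h2⟩

variable [CompleteSpace H]

lemma HasGraph.mem_closure_domain_iff (hT : HasGraph T J K) (hc : T.IsClosable) {x : H} :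
    x ∈ T.closure.domain ↔ ∃ φ : ℕ → D, Tendsto (fun n => J (φ n)) atTop (𝓝 x) ∧
      CauchySeq (fun n => K (φ n)) := by
  rw [LinearPMap.mem_domain_iff]
  constructor
  · rintro ⟨y, hy⟩
    obtain ⟨φ, h1, h2⟩ := (hT.mem_closure_graph_iff hc).1 hy
    exact ⟨φ, h1, h2.cauchySeq⟩
  · rintro ⟨φ, h1, h2⟩
    obtain ⟨y, hy⟩ := cauchySeq_tendsto_of_complete h2
    exact ⟨y, (hT.mem_closure_graph_iff hc).2 ⟨φ, h1, hy⟩⟩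

lemma mem_graph_adjoint_iff (hT : Dense (T.domain : Set H)) {y w : H} :
    (y, w) ∈ T.adjoint.graph ↔ ∀ p ∈ T.graph, inner ℂ w p.1 = inner ℂ y p.2 := by
  constructor
  · intro h p hp
    obtain ⟨y', hy, hw⟩ := (LinearPMap.mem_graph_iff _).1 h
    obtain ⟨x, hx, hTx⟩ := (LinearPMap.mem_graph_iff _).1 hp
    have := T.adjoint_isFormalAdjoint hT y' x
    simp only at hy hw
    rw [← hw, ← hy, ← hx, ← hTx]
    exact this
  · intro h
    have h' : ∀ x : T.domain, inner ℂ w (x : H) = inner ℂ y (T x) := fun x =>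
      h _ (T.mem_graph x)
    have hy : y ∈ T.adjoint.domain := LinearPMap.mem_adjoint_domain_of_exists _ ⟨w, h'⟩
    exact (LinearPMap.mem_graph_iff _).2 ⟨⟨y, hy⟩, rfl, LinearPMap.adjoint_apply_eq hT _ h'⟩

lemma HasGraph.mem_graph_adjoint_iff (hT : HasGraph T J K) (hJ : DenseRange J) {y w : H} :
    (y, w) ∈ T.adjoint.graph ↔ ∀ φ, inner ℂ w (J φ) = inner ℂ y (K φ) := by
  rw [BlochLandau.mem_graph_adjoint_iff (hT.dense_domain hJ)]
  constructor
  · intro h φ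
    exact h _ ((hT _).2 ⟨φ, rfl⟩)
  · intro h p hp
    obtain ⟨φ, rfl⟩ := (hT _).1 hp
    exact h φ

/-- A symmetric operator such that `T + l` is bounded below with dense range has a self-adjoint
closure, which coincides with the adjoint. -/
theorem HasGraph.essentiallySelfAdjoint (hT : HasGraph T J K) (hJ : DenseRange J)
    (hsymm : ∀ φ ψ, inner ℂ (K φ) (J ψ) = inner ℂ (J φ) (K ψ)) {l c : ℝ} (hc : 0 < c)
    (hlower : ∀ φ, c * ‖J φ‖ ≤ ‖K φ + (l : ℂ) • J φ‖)
    (hdense : ∀ u, (∀ φ, inner ℂ u (K φ + (l : ℂ) • J φ) = 0) → u = 0) :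
    T.IsClosable ∧ IsSelfAdjoint T.closure ∧ T.closure = T.adjoint := by
  have hTd := hT.dense_domain hJ
  have hle : T ≤ T.adjoint := by
    apply LinearPMap.le_of_le_graph
    intro p hp
    obtain ⟨φ, rfl⟩ := (hT _).1 hp
    exact (hT.mem_graph_adjoint_iff hJ).2 fun ψ => hsymm φ ψ
  have hcl : T.adjoint.IsClosed := T.adjoint_isClosed hTd
  have hclos : T.IsClosable := hcl.isClosable.leIsClosable hle
  have hgle : T.closure.graph ≤ T.adjoint.graph := by
    rw [← hclos.graph_closure_eq_closure_graph]
    exact Submodule.topologicalClosure_minimal _ (LinearPMap.le_graph_of_le hle) hcl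
  -- Given `(y, w)` in the graph of `T*`, solve `(T̄ + l) x = w + l y` by approximation. Then `y -
  -- x` lies in the kernel of `T* + l`, the orthogonal complement of the dense range, so `y = x`.
  have hge : T.adjoint.graph ≤ T.closure.graph := by
    rintro ⟨y, w⟩ hyw
    let R : Submodule ℂ H := LinearMap.range (K + (l : ℂ) • J)
    have hR : R.topologicalClosure = ⊤ := by
      rw [Submodule.topologicalClosure_eq_top_iff, Submodule.eq_bot_iff]
      intro u hu
      refine hdense u fun φ => ?_
      exact Submodule.inner_left_of_mem_orthogonal (K := R) ⟨φ, by simp⟩ hu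
    have hmem : w + (l : ℂ) • y ∈ closure (R : Set H) := by
      rw [← Submodule.topologicalClosure_coe, hR]; trivial
    obtain ⟨p, hp, hlim⟩ := mem_closure_iff_seq_limit.1 hmem
    choose φ hφ using hp
    have hφ' : ∀ n, K (φ n) + (l : ℂ) • J (φ n) = p n := fun n => by simpa using hφ n
    have hcau : CauchySeq (fun n => J (φ n)) := by
      have h1 := hlim.cauchySeq
      rw [Metric.cauchySeq_iff] at h1 ⊢
      intro ε hε
      obtain ⟨N, hN⟩ := h1 (c * ε) (by positivity)
      refine ⟨N, fun m hm n hn => ?_⟩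
      have h2 := hN m hm n hn
      rw [dist_eq_norm] at h2 ⊢
      have h3 := hlower (φ m - φ n)
      have h4 : K (φ m - φ n) + (l : ℂ) • J (φ m - φ n) = p m - p n := by
        rw [← hφ' m, ← hφ' n, map_sub, map_sub, smul_sub]; abel
      rw [h4, map_sub] at h3
      exact lt_of_mul_lt_mul_left (h3.trans_lt h2) hc.le
    obtain ⟨x, hx⟩ := cauchySeq_tendsto_of_complete hcau
    have hK : Tendsto (fun n => K (φ n)) atTop (𝓝 (w + (l : ℂ) • y - (l : ℂ) • x)) := by
      refine (hlim.sub (hx.const_smul (l : ℂ))).congr fun n => ?_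
      rw [← hφ' n]; abel
    have hxg : (x, w + (l : ℂ) • y - (l : ℂ) • x) ∈ T.closure.graph :=
      (hT.mem_closure_graph_iff hclos).2 ⟨φ, hx, hK⟩
    have h1 := (hT.mem_graph_adjoint_iff hJ).1 hyw
    have h2 := (hT.mem_graph_adjoint_iff hJ).1 (hgle hxg)
    have hyx : y - x = 0 := by
      refine hdense _ fun ψ => ?_
      have e1 := h1 ψ
      have e2 := h2 ψ
      simp only [inner_add_left, inner_sub_left, inner_smul_left, Complex.conj_ofReal] at e1 e2
      simp only [inner_sub_left, inner_add_right, inner_smul_right]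
      rw [← e1, ← e2]; ring
    have : y = x := sub_eq_zero.1 hyx
    subst this
    simpa using hxg
  have heq : T.closure = T.adjoint := LinearPMap.eq_of_eq_graph (le_antisymm hgle hge)
  refine ⟨hclos, ?_, heq⟩
  rw [LinearPMap.isSelfAdjoint_def]
  refine (LinearPMap.eq_of_eq_graph ?_).trans heq.symm
  -- By continuity of the inner product `T̄` and `T` have the same adjoint, and `T* = T̄` is already
  -- known.
  have hd : Dense (T.closure.domain : Set H) := hTd.mono T.le_closure.1
  ext ⟨y, w⟩
  rw [BlochLandau.mem_graph_adjoint_iff hd, hT.mem_graph_adjoint_iff hJ]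
  constructor
  · intro h φ
    exact h (J φ, K φ) (LinearPMap.le_graph_of_le T.le_closure ((hT _).2 ⟨φ, rfl⟩))
  · rintro h ⟨x, z⟩ hp
    obtain ⟨φ, h1, h2⟩ := (hT.mem_closure_graph_iff hclos).1 hp
    exact tendsto_nhds_unique ((tendsto_const_nhds.inner h1).congr fun n => h (φ n))
      (tendsto_const_nhds.inner h2)

/-- Kato–Rellich: the range of `K + l` is dense if that of `K₀ + l` is and `K - K₀` is bounded by
`K₀ + l` with relative bound less than one. -/
lemma dense_range_of_relatively_bounded {K₀ : D →ₗ[ℂ] H} {l ε : ℝ} (hε : ε < 1)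
    (hdense : ∀ u, (∀ φ, inner ℂ u (K₀ φ + (l : ℂ) • J φ) = 0) → u = 0)
    (hrel : ∀ φ, ‖K φ - K₀ φ‖ ≤ ε * ‖K₀ φ + (l : ℂ) • J φ‖) :
    ∀ u, (∀ φ, inner ℂ u (K φ + (l : ℂ) • J φ) = 0) → u = 0 := by
  intro u hu
  let R : Submodule ℂ H := LinearMap.range (K₀ + (l : ℂ) • J)
  have hR : R.topologicalClosure = ⊤ := by
    rw [Submodule.topologicalClosure_eq_top_iff, Submodule.eq_bot_iff]
    intro v hv
    refine hdense v fun φ => ?_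
    exact Submodule.inner_left_of_mem_orthogonal (K := R) ⟨φ, by simp⟩ hv
  have hmem : u ∈ closure (R : Set H) := by
    rw [← Submodule.topologicalClosure_coe, hR]; trivial
  obtain ⟨p, hp, hlim⟩ := mem_closure_iff_seq_limit.1 hmem
  choose φ hφ using hp
  have hφ' : ∀ n, K₀ (φ n) + (l : ℂ) • J (φ n) = p n := fun n => by simpa using hφ n
  -- Orthogonality of `u` to the perturbed range replaces `p n` by minus the perturbation. As `p n →
  -- u` this becomes `‖u‖² ≤ ε ‖u‖²`.
  have key : ∀ n, ‖inner ℂ u (p n)‖ ≤ ‖u‖ * (ε * ‖p n‖) := by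
    intro n
    have h1 : inner ℂ u (p n) = - inner ℂ u (K (φ n) - K₀ (φ n)) := by
      have := hu (φ n)
      have h2 : K (φ n) + (l : ℂ) • J (φ n) = p n + (K (φ n) - K₀ (φ n)) := by
        rw [← hφ' n]; abel
      rw [h2, inner_add_right] at this
      exact eq_neg_of_add_eq_zero_left this
    rw [h1, norm_neg]
    refine (norm_inner_le_norm _ _).trans ?_
    have := hrel (φ n)
    rw [hφ' n] at this
    gcongr
  have h1 : ‖inner ℂ u u‖ ≤ ‖u‖ * (ε * ‖u‖) :=
    le_of_tendsto_of_tendsto' (tendsto_const_nhds.inner hlim).norm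
      (tendsto_const_nhds.mul (tendsto_const_nhds.mul hlim.norm)) key
  rw [inner_self_eq_norm_sq_to_K] at h1
  have h2 : ‖((‖u‖ : ℂ)) ^ 2‖ = ‖u‖ ^ 2 := by simp
  have h3 : ‖u‖ ^ 2 ≤ ‖u‖ * (ε * ‖u‖) := by rw [← h2]; exact h1
  have h4 : ‖u‖ ^ 2 = 0 := by nlinarith [sq_nonneg ‖u‖]
  simpa using h4

end Abstract

end BlochLandau

namespace BlochLandau

open scoped ComplexConjugate

/-! ### Integration by parts for momentum operators -/

lemma inner_toLp {f g : Plane → ℂ} (hf : MemLp f 2 (volume : Measure Plane))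
    (hg : MemLp g 2 (volume : Measure Plane)) :
    inner ℂ (hf.toLp f) (hg.toLp g) = ∫ r, conj (f r) * g r := by
  rw [L2.inner_def]
  refine integral_congr_ae ?_
  filter_upwards [hf.coeFn_toLp, hg.coeFn_toLp] with r h1 h2
  rw [h1, h2, RCLike.inner_apply, mul_comm]

lemma fderiv_conj {φ : Plane → ℂ} {r : Plane} (h : DifferentiableAt ℝ φ r) (v : Plane) :
    fderiv ℝ (fun x => conj (φ x)) r v = conj (fderiv ℝ φ r v) := by
  have := (Complex.conjCLE.toContinuousLinearMap.hasFDerivAt (x := φ r)).comp r h.hasFDerivAt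
  change HasFDerivAt (fun x => conj (φ x)) _ r at this
  rw [this.fderiv]; rfl

lemma contDiff_conj {n : WithTop ℕ∞} {φ : Plane → ℂ} (h : ContDiff ℝ n φ) :
    ContDiff ℝ n (fun x => conj (φ x)) :=
  Complex.conjCLE.toContinuousLinearMap.contDiff.comp h

lemma hasCompactSupport_conj {φ : Plane → ℂ} (h : HasCompactSupport φ) :
    HasCompactSupport (fun x => conj (φ x)) :=
  h.comp_left (g := conj) (map_zero _)

lemma momentum_continuous {ħ κ : ℝ} {A : Plane → Plane} {j : Fin 2}
    (hA : Continuous fun r => A r j) {φ : Plane → ℂ} (hφ : ContDiff ℝ 1 φ) :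
    Continuous (momentum ħ κ A j φ) := by
  have h1 := hφ.continuous_fderiv (by simp)
  have h2 : Continuous fun r => (A r j : ℂ) := Complex.continuous_ofReal.comp hA
  exact (continuous_const.mul (h1.clm_apply continuous_const)).sub
    ((continuous_const.mul h2).mul hφ.continuous)

/-- Integration by parts: the factor `-i` absorbs the sign and `A` is real. Compact support of one
factor is enough, so that the other may be a Schwartz function. Class `C¹` suffices because one
momentum already lowers the regularity to that of `A`. -/
lemma integral_conj_momentum_mul {ħ κ : ℝ} {A : Plane → Plane} {j : Fin 2}
    (hA : Continuous fun r => A r j) {φ ψ : Plane → ℂ} (hφ : ContDiff ℝ 1 φ) (hψ : ContDiff ℝ 1 ψ)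
    (hc : HasCompactSupport φ) :
    ∫ r, conj (momentum ħ κ A j φ r) * ψ r = ∫ r, conj (φ r) * momentum ħ κ A j ψ r := by
  have cf : Continuous fun x => fderiv ℝ φ x (e j) :=
    (hφ.continuous_fderiv (by simp)).clm_apply continuous_const
  have cg : Continuous fun x => fderiv ℝ ψ x (e j) :=
    (hψ.continuous_fderiv (by simp)).clm_apply continuous_const
  have hψ0 := hψ.continuous
  have cφ : Continuous fun x => conj (φ x) := Complex.continuous_conj.comp hφ.continuous
  have cf' : Continuous fun x => conj (fderiv ℝ φ x (e j)) := Complex.continuous_conj.comp cf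
  have cA : Continuous fun r => (A r j : ℂ) := Complex.continuous_ofReal.comp hA
  have sφ : HasCompactSupport fun x => conj (φ x) := hasCompactSupport_conj hc
  have sf : HasCompactSupport fun x => conj (fderiv ℝ φ x (e j)) :=
    hasCompactSupport_conj (hc.fderiv_apply (𝕜 := ℝ) (e j))
  have i1 : Integrable (fun x => conj (fderiv ℝ φ x (e j)) * ψ x) (volume : Measure Plane) :=
    Continuous.integrable_of_hasCompactSupport (cf'.mul hψ0) sf.mul_right
  have i2 : Integrable (fun x => conj (φ x) * fderiv ℝ ψ x (e j)) (volume : Measure Plane) :=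
    Continuous.integrable_of_hasCompactSupport (cφ.mul cg) sφ.mul_right
  have i3 : Integrable (fun x => conj (φ x) * ψ x) (volume : Measure Plane) :=
    Continuous.integrable_of_hasCompactSupport (cφ.mul hψ0) sφ.mul_right
  have i4 : Integrable (fun x => conj (φ x) * (κ * (A x j : ℂ) * ψ x)) (volume : Measure Plane) :=
    Continuous.integrable_of_hasCompactSupport
      (cφ.mul ((continuous_const.mul cA).mul hψ0)) sφ.mul_right
  have dφ := hφ.differentiable (by simp)
  have hd : ∀ x, fderiv ℝ (fun x => conj (φ x)) x (e j) = conj (fderiv ℝ φ x (e j)) :=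
    fun x => fderiv_conj (dφ x) _
  have key := integral_mul_fderiv_eq_neg_fderiv_mul_of_integrable (μ := (volume : Measure Plane))
    (f := fun x => conj (φ x)) (g := ψ) (v := e j) (by simpa only [hd] using i1) i2 i3
    (fun x _ => (contDiff_conj hφ).differentiable (by simp) x)
    (fun x _ => hψ.differentiable (by simp) x)
  simp only [hd] at key
  have e1 : ∀ r, conj (momentum ħ κ A j φ r) * ψ r =
      Complex.I * ħ * (conj (fderiv ℝ φ r (e j)) * ψ r) -
        conj (φ r) * (κ * (A r j : ℂ) * ψ r) := by
    intro r
    simp only [momentum, map_sub, map_mul, map_neg, Complex.conj_I, Complex.conj_ofReal]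
    ring
  have e2 : ∀ r, conj (φ r) * momentum ħ κ A j ψ r =
      -(Complex.I * ħ) * (conj (φ r) * fderiv ℝ ψ r (e j)) -
        conj (φ r) * (κ * (A r j : ℂ) * ψ r) := by
    intro r
    simp only [momentum]
    ring
  simp only [e1, e2]
  rw [integral_sub (i1.const_mul _) i4, integral_sub (i2.const_mul _) i4, integral_const_mul,
    integral_const_mul, key]
  ring

/-! ### The Hamiltonian on test functions -/

lemma memLp_test (φ : testFunctions) : MemLp φ.1 2 (volume : Measure Plane) :=
  φ.2.1.continuous.memLp_of_hasCompactSupport φ.2.2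

lemma testToL2_apply (φ : testFunctions) : testToL2 φ = (memLp_test φ).toLp φ.1 := rfl

lemma inner_testToL2 (φ ψ : testFunctions) :
    inner ℂ (testToL2 φ) (testToL2 ψ) = ∫ r, conj (φ.1 r) * ψ.1 r :=
  inner_toLp (memLp_test φ) (memLp_test ψ)

lemma denseRange_testToL2 : DenseRange testToL2 := by
  refine (Lp.dense_hasCompactSupport_contDiff (E := Plane) (F := ℂ) (p := 2) (μ := volume)
    (by simp)).mono ?_
  rintro f ⟨g, hfg, hg, hg'⟩
  refine ⟨⟨g, hg', hg⟩, ?_⟩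
  ext1
  exact (memLp_test ⟨g, hg', hg⟩).coeFn_toLp.trans hfg.symm

lemma hamiltonianOnTest_symmetric {m ħ κ : ℝ} {A : Plane → Plane} {V : Plane → ℝ}
    (hA : ∀ j, ContDiff ℝ 1 (fun r => A r j)) (hV : IsLocallyL2 V) (φ ψ : testFunctions) :
    inner ℂ (hamiltonianOnTest m ħ κ A V hA hV φ) (testToL2 ψ) =
      inner ℂ (testToL2 φ) (hamiltonianOnTest m ħ κ A V hA hV ψ) := by
  have c0 (j : Fin 2) : Continuous fun r => A r j := (hA j).continuous
  have c1 (χ : testFunctions) (j : Fin 2) : ContDiff ℝ 1 (momentum ħ κ A j χ.1) :=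
    momentum_contDiff (k := 1) (n := ⊤) le_top (by exact_mod_cast hA j) χ.2.1
  have c2 (χ : testFunctions) (j : Fin 2) :
      Continuous (momentum ħ κ A j (momentum ħ κ A j χ.1)) :=
    momentum_continuous (c0 j) (c1 χ j)
  have c3 (χ : testFunctions) : ContDiff ℝ 1 χ.1 := χ.2.1.of_le (by simp)
  have s1 (χ : testFunctions) (j : Fin 2) : HasCompactSupport (momentum ħ κ A j χ.1) :=
    momentum_hasCompactSupport χ.2.2
  have m0 (χ : testFunctions) : MemLp χ.1 2 (volume : Measure Plane) :=
    χ.2.1.continuous.memLp_of_hasCompactSupport χ.2.2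
  have m2 (χ : testFunctions) (j : Fin 2) :
      MemLp (momentum ħ κ A j (momentum ħ κ A j χ.1)) 2 (volume : Measure Plane) :=
    (c2 χ j).memLp_of_hasCompactSupport (momentum_hasCompactSupport (s1 χ j))
  have mV (χ : testFunctions) : MemLp (fun r => (V r : ℂ) * χ.1 r) 2 (volume : Measure Plane) :=
    memLp_potential_mul hV χ.2.1.continuous χ.2.2
  have e1 (χ : testFunctions) : hamiltonianOnTest m ħ κ A V hA hV χ =
      (1 / (2 * (m : ℂ))) • ∑ j, (m2 χ j).toLp _ + (mV χ).toLp _ := by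
    simp only [Fin.sum_univ_two, ← MemLp.toLp_add, ← MemLp.toLp_const_smul]
    exact MemLp.toLp_congr (memLp_hamiltonianExpr hA hV χ.2) _ (.of_forall fun r => by
      simp [hamiltonianExpr, Fin.sum_univ_two, mul_add])
  have e3 (χ : testFunctions) : testToL2 χ = (m0 χ).toLp _ := rfl
  have hmom (j : Fin 2) : inner ℂ ((m2 φ j).toLp _) ((m0 ψ).toLp _) =
      inner ℂ ((m0 φ).toLp _) ((m2 ψ j).toLp _) := by
    rw [inner_toLp, inner_toLp, integral_conj_momentum_mul (c0 j) (c1 φ j) (c3 ψ) (s1 φ j),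
      integral_conj_momentum_mul (c0 j) (c3 φ) (c1 ψ j) φ.2.2]
  have hpot : inner ℂ ((mV φ).toLp _) ((m0 ψ).toLp _) =
      inner ℂ ((m0 φ).toLp _) ((mV ψ).toLp _) := by
    rw [inner_toLp, inner_toLp]
    congr 1
    funext r
    simp only [map_mul, Complex.conj_ofReal]
    ring
  have hm : conj (1 / (2 * (m : ℂ))) = 1 / (2 * (m : ℂ)) := by
    simp [Complex.conj_ofReal, Complex.conj_ofNat]
  rw [e1, e1, e3, e3, inner_add_left, inner_add_right, inner_smul_left, inner_smul_right, hpot,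
    sum_inner, inner_sum, hm]
  simp only [hmom]

lemma hasGraph_schrodinger {m ħ κ : ℝ} {A : Plane → Plane} {V : Plane → ℝ}
    (hA : ∀ j, ContDiff ℝ 1 (fun r => A r j)) (hV : IsLocallyL2 V) :
    HasGraph (schrodinger m ħ κ A V hA hV) testToL2 (hamiltonianOnTest m ħ κ A V hA hV) := by
  intro p
  rw [LinearPMap.mem_graph_iff]
  constructor
  · rintro ⟨⟨x, φ, rfl⟩, h1, h2⟩
    exact ⟨φ, Prod.ext h1 ((schrodinger_apply m ħ κ A V hA hV φ).symm.trans h2)⟩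
  · rintro ⟨φ, rfl⟩
    exact ⟨⟨testToL2 φ, φ, rfl⟩, rfl, schrodinger_apply m ħ κ A V hA hV φ⟩

/-! ### Covariant momenta in a uniform field -/

lemma contDiff_uniformPotential {n : WithTop ℕ∞} (β : ℝ) (j : Fin 2) :
    ContDiff ℝ n (fun r => uniformPotential β r j) := by
  fin_cases j <;> simp [uniformPotential] <;> fun_prop

/-- The covariant momentum `-i ∂_j - (A_β)_j` as an endomorphism of `C^∞_c`. -/
noncomputable def covMomentum (β : ℝ) (j : Fin 2) : testFunctions →ₗ[ℂ] testFunctions where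
  toFun φ := ⟨momentum 1 1 (uniformPotential β) j φ.1,
    momentum_contDiff (k := ⊤) (n := ⊤) le_top (contDiff_uniformPotential β j) φ.2.1,
    momentum_hasCompactSupport φ.2.2⟩
  map_add' φ ψ := Subtype.ext (momentum_add (φ.2.1.differentiable (by simp))
    (ψ.2.1.differentiable (by simp)))
  map_smul' c φ := Subtype.ext (momentum_smul c (φ.2.1.differentiable (by simp)))

lemma covMomentum_apply (β : ℝ) (j : Fin 2) (φ : testFunctions) (r : Plane) :
    (covMomentum β j φ).1 r =
      -Complex.I * fderiv ℝ φ.1 r (e j) - (uniformPotential β r j : ℂ) * φ.1 r := by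
  simp [covMomentum, momentum]

lemma covMomentum_symmetric (β : ℝ) (j : Fin 2) (φ ψ : testFunctions) :
    inner ℂ (testToL2 (covMomentum β j φ)) (testToL2 ψ) =
      inner ℂ (testToL2 φ) (testToL2 (covMomentum β j ψ)) := by
  rw [inner_testToL2, inner_testToL2]
  exact integral_conj_momentum_mul (contDiff_uniformPotential (n := 1) β j).continuous
    (φ.2.1.of_le (by simp)) (ψ.2.1.of_le (by simp)) φ.2.2

/-- The covariant Laplacian `∑_j (-i ∂_j - (A_β)_j)²`. -/
noncomputable def covLaplacian (β : ℝ) : testFunctions →ₗ[ℂ] testFunctions :=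
  ∑ j, covMomentum β j ∘ₗ covMomentum β j

lemma covLaplacian_apply (β : ℝ) (φ : testFunctions) :
    covLaplacian β φ = covMomentum β 0 (covMomentum β 0 φ) + covMomentum β 1 (covMomentum β 1 φ) := by
  simp [covLaplacian, Fin.sum_univ_two]

lemma hasFDerivAt_uniformPotential (β : ℝ) (j : Fin 2) (r : Plane) :
    HasFDerivAt (fun x => uniformPotential β x j)
      (if j = 0 then -(β / 2) • (EuclideanSpace.proj 1 : Plane →L[ℝ] ℝ)
        else (β / 2) • (EuclideanSpace.proj 0 : Plane →L[ℝ] ℝ)) r := by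
  fin_cases j
  · exact ((EuclideanSpace.proj 1 : Plane →L[ℝ] ℝ).hasFDerivAt).const_mul (-(β / 2))
  · exact ((EuclideanSpace.proj 0 : Plane →L[ℝ] ℝ).hasFDerivAt).const_mul (β / 2)

lemma fderiv_covMomentum (β : ℝ) (j : Fin 2) (φ : testFunctions) (r v : Plane) :
    fderiv ℝ (covMomentum β j φ).1 r v =
      -Complex.I * fderiv ℝ (fderiv ℝ φ.1) r v (e j) -
        ((uniformPotential β r j : ℂ) * fderiv ℝ φ.1 r v +
          (fderiv ℝ (fun x => uniformPotential β x j) r v : ℂ) * φ.1 r) := by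
  have h1 : HasFDerivAt φ.1 (fderiv ℝ φ.1 r) r :=
    (φ.2.1.differentiable (by simp) r).hasFDerivAt
  have h2 : HasFDerivAt (fderiv ℝ φ.1) (fderiv ℝ (fderiv ℝ φ.1) r) r :=
    (((φ.2.1.fderiv_right (m := 1) (n := ∞)
    (by norm_num; exact WithTop.coe_le_coe.2 le_top)).differentiable (by simp)) r).hasFDerivAt
  have h3 : HasFDerivAt (fun x => uniformPotential β x j)
      (fderiv ℝ (fun x => uniformPotential β x j) r) r :=
    (((contDiff_uniformPotential (n := 1) β j).differentiable (by simp)) r).hasFDerivAt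
  have h4 := (Complex.ofRealCLM.hasFDerivAt (x := uniformPotential β r j)).comp r h3
  have h5 := ((h2.clm_apply (hasFDerivAt_const (e j) r)).const_mul (-Complex.I)).sub (h4.mul h1)
  have h6 : (covMomentum β j φ).1 = fun r => -Complex.I * fderiv ℝ φ.1 r (e j) -
      (Complex.ofRealCLM ∘ fun x => uniformPotential β x j) r * φ.1 r := by
    funext r
    exact covMomentum_apply β j φ r
  rw [h6]
  refine (congrArg (fun L => L v) h5.fderiv).trans ?_
  simp
  ring

/-- Second derivatives commute, so only the curl of `A_β` remains, and it equals `β`. -/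
lemma covMomentum_comm (β : ℝ) (φ : testFunctions) :
    covMomentum β 0 (covMomentum β 1 φ) - covMomentum β 1 (covMomentum β 0 φ) =
      (Complex.I * β) • φ := by
  apply Subtype.ext
  funext r
  have hs : fderiv ℝ (fderiv ℝ φ.1) r (e 0) (e 1) = fderiv ℝ (fderiv ℝ φ.1) r (e 1) (e 0) :=
    (φ.2.1.contDiffAt (x := r)).isSymmSndFDerivAt (by simp; exact WithTop.coe_le_coe.2 le_top) _ _
  change (covMomentum β 0 (covMomentum β 1 φ)).1 r - (covMomentum β 1 (covMomentum β 0 φ)).1 r =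
    (Complex.I * β) * φ.1 r
  simp only [covMomentum_apply, fderiv_covMomentum]
  rw [hs, (hasFDerivAt_uniformPotential β 0 r).fderiv,
    (hasFDerivAt_uniformPotential β 1 r).fderiv]
  simp
  ring

/-- The source both of the bound on first derivatives and of the positivity of the model operator.
-/
lemma inner_covLaplacian_self (β : ℝ) (φ : testFunctions) :
    inner ℂ (testToL2 (covLaplacian β φ)) (testToL2 φ) =
      ((‖testToL2 (covMomentum β 0 φ)‖ ^ 2 + ‖testToL2 (covMomentum β 1 φ)‖ ^ 2 : ℝ) : ℂ) := by
  rw [covLaplacian_apply, map_add, inner_add_left, covMomentum_symmetric β 0 _ φ,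
    covMomentum_symmetric β 1 _ φ, inner_self_eq_norm_sq_to_K, inner_self_eq_norm_sq_to_K]
  push_cast; rfl

lemma sum_norm_sq_covMomentum_le (β : ℝ) (φ : testFunctions) :
    ‖testToL2 (covMomentum β 0 φ)‖ ^ 2 + ‖testToL2 (covMomentum β 1 φ)‖ ^ 2 ≤
      ‖testToL2 φ‖ * ‖testToL2 (covLaplacian β φ)‖ := by
  have h1 := norm_inner_le_norm (𝕜 := ℂ) (testToL2 (covLaplacian β φ)) (testToL2 φ)
  rw [inner_covLaplacian_self, Complex.norm_real, mul_comm] at h1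
  exact (le_abs_self _).trans h1

lemma norm_sq_covLaplacian (β : ℝ) (φ : testFunctions) :
    ‖testToL2 (covMomentum β 0 (covMomentum β 0 φ))‖ ^ 2 +
      ‖testToL2 (covMomentum β 1 (covMomentum β 1 φ))‖ ^ 2 +
      2 * ‖testToL2 (covMomentum β 1 (covMomentum β 0 φ))‖ ^ 2 ≤
    ‖testToL2 (covLaplacian β φ)‖ ^ 2 +
      4 * |β| * (‖testToL2 (covMomentum β 0 φ)‖ * ‖testToL2 (covMomentum β 1 φ)‖) := by
  have hc (χ : testFunctions) : covMomentum β 0 (covMomentum β 1 χ) =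
      covMomentum β 1 (covMomentum β 0 χ) + (Complex.I * β) • χ := by
    rw [← covMomentum_comm]; abel
  have hc' (χ : testFunctions) : covMomentum β 1 (covMomentum β 0 χ) =
      covMomentum β 0 (covMomentum β 1 χ) - (Complex.I * β) • χ := by
    rw [← covMomentum_comm]; abel
  set J := testToL2
  set P := covMomentum β 0
  set Q := covMomentum β 1
  -- Moving one `Q` to the left and one `P` to the right costs two commutators, each contributing
  -- `iβ ⟨Pφ, Qφ⟩`. What is left is the square of the mixed derivative.
  have h1 : inner ℂ (J (P (P φ))) (J (Q (Q φ))) =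
      inner ℂ (J (Q (P φ))) (J (Q (P φ))) +
        2 * (Complex.I * β) * inner ℂ (J (P φ)) (J (Q φ)) := by
    rw [← covMomentum_symmetric β 1 (P (P φ)) (Q φ)]
    change inner ℂ (J (Q (P (P φ)))) (J (Q φ)) = _
    have s0 (χ η : testFunctions) : inner ℂ (J (P χ)) (J η) = inner ℂ (J χ) (J (P η)) :=
      covMomentum_symmetric β 0 χ η
    have s1 (χ η : testFunctions) : inner ℂ (J (Q χ)) (J η) = inner ℂ (J χ) (J (Q η)) :=
      covMomentum_symmetric β 1 χ η
    rw [hc' (P φ), map_sub, map_smul, inner_sub_left, inner_smul_left,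
      s0 (Q (P φ)), hc φ, map_add, map_smul, inner_add_right, inner_smul_right,
      s1 (P φ) φ]
    simp only [map_mul, Complex.conj_I, Complex.conj_ofReal]
    ring
  have h2 : ‖J (covLaplacian β φ)‖ ^ 2 = ‖J (P (P φ))‖ ^ 2 +
      2 * RCLike.re (inner ℂ (J (P (P φ))) (J (Q (Q φ)))) + ‖J (Q (Q φ))‖ ^ 2 := by
    rw [covLaplacian_apply, map_add, @norm_add_sq ℂ]
  rw [h1, inner_self_eq_norm_sq_to_K] at h2
  have h3 : RCLike.re ((((‖J (Q (P φ))‖ : ℝ) : ℂ)) ^ 2 +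
      2 * (Complex.I * β) * inner ℂ (J (P φ)) (J (Q φ))) = ‖J (Q (P φ))‖ ^ 2 +
      RCLike.re (2 * (Complex.I * β) * inner ℂ (J (P φ)) (J (Q φ)) : ℂ) := by
    rw [map_add, ← Complex.ofReal_pow]
    rfl
  have h4 : |RCLike.re (2 * (Complex.I * β) * inner ℂ (J (P φ)) (J (Q φ)) : ℂ)| ≤
      2 * |β| * (‖J (P φ)‖ * ‖J (Q φ)‖) := by
    refine (RCLike.abs_re_le_norm _).trans ?_
    rw [norm_mul]
    have : ‖(2 * (Complex.I * β) : ℂ)‖ = 2 * |β| := by simp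
    rw [this]
    gcongr
    exact norm_inner_le_norm _ _
  have h5 := neg_le_of_abs_le h4
  have h6 : RCLike.re ((((‖J (Q (P φ))‖ : ℝ) : ℂ)) ^ 2 +
      2 * (Complex.I * β) * inner ℂ (J (P φ)) (J (Q φ))) = _ := h3
  change _ = _ + 2 * RCLike.re ((((‖J (Q (P φ))‖ : ℝ) : ℂ)) ^ 2 +
      2 * (Complex.I * β) * inner ℂ (J (P φ)) (J (Q φ))) + _ at h2
  rw [h3] at h2
  linarith

end BlochLandau

namespace BlochLandau

open scoped ComplexConjugate
open Filter Topology

/-! ### A maximum principle -/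

/-- A positive second derivative would make `0` a local minimum too, so `f` would be locally
constant with vanishing second derivative. -/
lemma second_deriv_nonpos_of_isLocalMax {f f₁ : ℝ → ℝ} {c : ℝ} (hf : ∀ t, HasDerivAt f (f₁ t) t)
    (hf₁ : HasDerivAt f₁ c 0) (hmax : IsLocalMax f 0) : c ≤ 0 := by
  by_contra! hc
  have hd : deriv f = f₁ := funext fun t => (hf t).deriv
  have h1 : IsLocalMin f 0 := by
    refine isLocalMin_of_deriv_deriv_pos ?_ hmax.deriv_eq_zero (hf 0).continuousAt
    rw [hd, hf₁.deriv]
    exact hc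
  have h2 : ∀ᶠ t in 𝓝 0, f t = f 0 := by
    filter_upwards [h1, hmax] with t ht ht'
    exact le_antisymm ht' ht
  have h3 : f₁ =ᶠ[𝓝 0] fun _ => 0 := by
    filter_upwards [h2.eventually_nhds] with t ht
    rw [← (hf t).deriv]
    have : f =ᶠ[𝓝 t] fun _ => f 0 := ht
    rw [this.deriv_eq, deriv_const]
  have h4 := h3.deriv_eq
  rw [hf₁.deriv, deriv_const] at h4
  exact hc.ne' h4

lemma norm_sq_add_smul_e (x : Plane) (j : Fin 2) (t : ℝ) :
    ‖x + t • e j‖ ^ 2 = ‖x‖ ^ 2 + 2 * x j * t + t ^ 2 := by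
  simp only [EuclideanSpace.norm_sq_eq, Fin.sum_univ_two, Real.norm_eq_abs, sq_abs]
  fin_cases j <;> simp <;> ring

/-- A bounded function on the plane with `Δ w ≥ l w` and `l > 0` is nonpositive. -/
lemma nonpos_of_laplacian_ge {w : Plane → ℝ} {w₁ w₂ : Fin 2 → Plane → ℝ} {l C : ℝ} (hl : 0 < l)
    (hw : Continuous w) (hC : ∀ x, w x ≤ C)
    (h₁ : ∀ j x t, HasDerivAt (fun s : ℝ => w (x + s • e j)) (w₁ j (x + t • e j)) t)
    (h₂ : ∀ j x t, HasDerivAt (fun s : ℝ => w₁ j (x + s • e j)) (w₂ j (x + t • e j)) t)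
    (hlap : ∀ x, l * w x ≤ w₂ 0 x + w₂ 1 x) (x : Plane) : w x ≤ 0 := by
  -- A bounded function on the plane need not attain its supremum, but `w - δ ‖·‖²` does. At its
  -- maximum point both second derivatives of `w` are at most `2δ`, hence `l w ≤ 4δ` there.
  have key : ∀ δ : ℝ, 0 < δ → w x ≤ δ * (4 / l + ‖x‖ ^ 2) := by
    intro δ hδ
    have hcont : Continuous fun y => w y - δ * ‖y‖ ^ 2 := by fun_prop
    have hlim : Tendsto (fun y : Plane => w y - δ * ‖y‖ ^ 2) (cocompact Plane) atBot := by
      refine tendsto_atBot_mono (fun y => sub_le_sub_right (hC y) (δ * ‖y‖ ^ 2)) ?_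
      refine tendsto_atBot_add_const_left _ C (tendsto_neg_atTop_atBot.comp ?_) |>.congr
        fun y => (sub_eq_add_neg _ _).symm
      exact ((tendsto_pow_atTop two_ne_zero).comp (tendsto_norm_cocompact_atTop)).const_mul_atTop hδ
    obtain ⟨x₀, hx₀⟩ := hcont.exists_forall_ge hlim
    have hj : ∀ j, w₂ j x₀ ≤ 2 * δ := by
      intro j
      have d1 : ∀ t, HasDerivAt (fun s : ℝ => w (x₀ + s • e j) - δ * ‖x₀ + s • e j‖ ^ 2)
          (w₁ j (x₀ + t • e j) - δ * (2 * x₀ j + 2 * t)) t := by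
        intro t
        refine (h₁ j x₀ t).sub (HasDerivAt.const_mul δ ?_)
        simp only [norm_sq_add_smul_e]
        have := (((hasDerivAt_id t).const_mul (2 * x₀ j)).const_add (‖x₀‖ ^ 2)).fun_add
          (hasDerivAt_pow 2 t)
        simpa using this
      have d2 : HasDerivAt (fun t => w₁ j (x₀ + t • e j) - δ * (2 * x₀ j + 2 * t))
          (w₂ j x₀ - δ * 2) 0 := by
        have h3 := h₂ j x₀ 0
        rw [zero_smul, add_zero] at h3
        refine h3.sub (HasDerivAt.const_mul δ ?_)
        simpa using ((hasDerivAt_id (0 : ℝ)).const_mul 2).const_add (2 * x₀ j)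
      have hm : IsLocalMax (fun s : ℝ => w (x₀ + s • e j) - δ * ‖x₀ + s • e j‖ ^ 2) 0 := by
        refine Eventually.of_forall fun s => ?_
        simpa using hx₀ (x₀ + s • e j)
      linarith [second_deriv_nonpos_of_isLocalMax d1 d2 hm]
    have h3 : w x₀ ≤ 4 * δ / l := by
      rw [le_div_iff₀ hl]
      linarith [hlap x₀, hj 0, hj 1]
    have h4 := hx₀ x
    have h5 : 0 ≤ δ * ‖x₀‖ ^ 2 := by positivity
    have h6 : δ * (4 / l + ‖x‖ ^ 2) = 4 * δ / l + δ * ‖x‖ ^ 2 := by ring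
    rw [h6]
    linarith
  have hlim : Tendsto (fun δ : ℝ => δ * (4 / l + ‖x‖ ^ 2)) (𝓝[>] 0) (𝓝 0) := by
    have : Tendsto (fun δ : ℝ => δ * (4 / l + ‖x‖ ^ 2)) (𝓝 0) (𝓝 (0 * (4 / l + ‖x‖ ^ 2))) :=
      tendsto_id.mul_const _
    rw [zero_mul] at this
    exact this.mono_left nhdsWithin_le_nhds
  exact ge_of_tendsto hlim (eventually_nhdsWithin_of_forall key)

/-! ### Magnetic translations -/

lemma hasDerivAt_comp_line {φ : Plane → ℂ} (h : Differentiable ℝ φ) (x v : Plane) (t : ℝ) :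
    HasDerivAt (fun s : ℝ => φ (x + s • v)) (fderiv ℝ φ (x + t • v) v) t := by
  have h1 : HasDerivAt (fun s : ℝ => x + s • v) v t := by
    simpa using ((hasDerivAt_id t).smul_const v).const_add x
  exact (h (x + t • v)).hasFDerivAt.comp_hasDerivAt t h1

/-- The phase `-A_β(x) · y`. -/
noncomputable def magneticPhase (β : ℝ) (x y : Plane) : ℝ :=
  -(uniformPotential β x 0 * y 0 + uniformPotential β x 1 * y 1)

lemma contDiff_magneticPhase {n : WithTop ℕ∞} (β : ℝ) (x : Plane) :
    ContDiff ℝ n (magneticPhase β x) := by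
  unfold magneticPhase; fun_prop

lemma magneticPhase_zero_left (β : ℝ) (y : Plane) : magneticPhase β 0 y = 0 := by
  simp [magneticPhase, uniformPotential]

/-- In the symmetric gauge the phase is antisymmetric, `-A_β(x) · y = A_β(y) · x`. -/
lemma magneticPhase_add_left (β : ℝ) (x y : Plane) (j : Fin 2) (t : ℝ) :
    magneticPhase β (x + t • e j) y = magneticPhase β x y + t * uniformPotential β y j := by
  fin_cases j <;> simp [magneticPhase, uniformPotential] <;> ring

lemma magneticPhase_add_right (β : ℝ) (x y : Plane) (j : Fin 2) (t : ℝ) :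
    magneticPhase β x (y + t • e j) = magneticPhase β x y - t * uniformPotential β x j := by
  fin_cases j <;> simp [magneticPhase, uniformPotential] <;> ring

lemma uniformPotential_sub (β : ℝ) (x y : Plane) (j : Fin 2) :
    uniformPotential β (x - y) j = uniformPotential β x j - uniformPotential β y j := by
  fin_cases j <;> simp [uniformPotential] <;> ring

lemma uniformPotential_add_smul (β : ℝ) (x : Plane) (j : Fin 2) (t : ℝ) :
    uniformPotential β (x + t • e j) j = uniformPotential β x j := by
  fin_cases j <;> simp [uniformPotential]

/-- The reflected and magnetically translated function `y ↦ φ (x - y) exp (-i A_β(x) · y)`. -/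
noncomputable def magneticTranslate (β : ℝ) (x : Plane) : testFunctions →ₗ[ℂ] testFunctions where
  toFun φ := ⟨fun y => φ.1 (x - y) * Complex.exp (Complex.I * magneticPhase β x y),
    (φ.2.1.comp (contDiff_const.sub contDiff_id)).mul
      (Complex.contDiff_exp.comp (contDiff_const.mul
        (Complex.ofRealCLM.contDiff.comp (contDiff_magneticPhase β x)))),
    (φ.2.2.comp_homeomorph (Homeomorph.subLeft x)).mul_right⟩
  map_add' _ _ := Subtype.ext (funext fun _ => add_mul _ _ _)
  map_smul' _ _ := Subtype.ext (funext fun _ => mul_assoc _ _ _)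

lemma magneticTranslate_apply (β : ℝ) (x y : Plane) (φ : testFunctions) :
    (magneticTranslate β x φ).1 y = φ.1 (x - y) * Complex.exp (Complex.I * magneticPhase β x y) :=
  rfl

lemma norm_magneticTranslate_apply (β : ℝ) (x y : Plane) (φ : testFunctions) :
    ‖(magneticTranslate β x φ).1 y‖ = ‖φ.1 (x - y)‖ := by
  rw [magneticTranslate_apply, norm_mul, mul_comm Complex.I, Complex.norm_exp_ofReal_mul_I, mul_one]

/-- The reflection reverses the derivative and the phase compensates the shift of the potential, up
to a term whose coefficient is independent of `y`. The covariant Laplacian of a translate is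
therefore a combination of translates. -/
lemma covMomentum_magneticTranslate (β : ℝ) (x : Plane) (j : Fin 2) (φ : testFunctions) :
    covMomentum β j (magneticTranslate β x φ) = -magneticTranslate β x (covMomentum β j φ) -
      (2 * (uniformPotential β x j : ℂ)) • magneticTranslate β x φ := by
  apply Subtype.ext
  funext y
  change (covMomentum β j (magneticTranslate β x φ)).1 y =
    -(magneticTranslate β x (covMomentum β j φ)).1 y -
      (2 * (uniformPotential β x j : ℂ)) * (magneticTranslate β x φ).1 y
  have h1 := hasDerivAt_comp_line (φ := (magneticTranslate β x φ).1)
    ((magneticTranslate β x φ).2.1.differentiable (by simp)) y (e j) 0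
  rw [zero_smul, add_zero] at h1
  have h2 : HasDerivAt (fun s : ℝ => φ.1 (x - (y + s • e j))) (-fderiv ℝ φ.1 (x - y) (e j)) 0 := by
    have := hasDerivAt_comp_line (φ.2.1.differentiable (by simp)) (x - y) (-e j) 0
    simp only [zero_smul, add_zero, map_neg] at this
    refine this.congr_of_eventuallyEq (.of_forall fun s => ?_)
    beta_reduce
    rw [smul_neg, ← sub_eq_add_neg, sub_sub]
  have h3 : HasDerivAt (fun s : ℝ => Complex.exp (Complex.I * magneticPhase β x (y + s • e j)))
      (Complex.exp (Complex.I * magneticPhase β x y) * (Complex.I * (-uniformPotential β x j))) 0 := by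
    simp only [magneticPhase_add_right]
    have h4 : HasDerivAt (fun s : ℝ => magneticPhase β x y - s * uniformPotential β x j)
        (-uniformPotential β x j) 0 := by
      simpa using ((hasDerivAt_id (0 : ℝ)).mul_const (uniformPotential β x j)).const_sub
        (magneticPhase β x y)
    have := (h4.ofReal_comp.const_mul Complex.I).cexp
    simpa using this
  have h5 := h1.unique (h2.mul h3)
  simp only [zero_smul, add_zero] at h5
  rw [covMomentum_apply, h5, magneticTranslate_apply, magneticTranslate_apply, covMomentum_apply,
    uniformPotential_sub]
  push_cast
  ring_nf
  simp only [Complex.I_sq]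
  ring

lemma covMomentum_sq_magneticTranslate (β : ℝ) (x : Plane) (j : Fin 2) (φ : testFunctions) :
    covMomentum β j (covMomentum β j (magneticTranslate β x φ)) =
      magneticTranslate β x (covMomentum β j (covMomentum β j φ)) +
      (4 * (uniformPotential β x j : ℂ)) • magneticTranslate β x (covMomentum β j φ) +
      (4 * (uniformPotential β x j : ℂ) ^ 2) • magneticTranslate β x φ := by
  rw [covMomentum_magneticTranslate, map_sub, map_neg, map_smul, covMomentum_magneticTranslate,
    covMomentum_magneticTranslate]
  module

lemma hasDerivAt_magneticTranslate (β : ℝ) (x y : Plane) (j : Fin 2) (φ : testFunctions) (t : ℝ) :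
    HasDerivAt (fun s : ℝ => (magneticTranslate β (x + s • e j) φ).1 y)
      (Complex.I * (magneticTranslate β (x + t • e j) (covMomentum β j φ)).1 y +
        Complex.I * uniformPotential β x j * (magneticTranslate β (x + t • e j) φ).1 y) t := by
  have h2 : HasDerivAt (fun s : ℝ => φ.1 (x + s • e j - y))
      (fderiv ℝ φ.1 (x + t • e j - y) (e j)) t := by
    have := hasDerivAt_comp_line (φ.2.1.differentiable (by simp)) (x - y) (e j) t
    simpa only [sub_add_eq_add_sub] using this
  have h3 : HasDerivAt (fun s : ℝ => Complex.exp (Complex.I * magneticPhase β (x + s • e j) y))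
      (Complex.exp (Complex.I * magneticPhase β (x + t • e j) y) *
        (Complex.I * (uniformPotential β y j))) t := by
    simp only [magneticPhase_add_left]
    have h4 : HasDerivAt (fun s : ℝ => magneticPhase β x y + s * uniformPotential β y j)
        (uniformPotential β y j) t := by
      simpa using ((hasDerivAt_id t).mul_const (uniformPotential β y j)).const_add
        (magneticPhase β x y)
    exact (h4.ofReal_comp.const_mul Complex.I).cexp
  convert! h2.mul h3 using 1
  simp only [magneticTranslate_apply, covMomentum_apply, uniformPotential_sub,
    uniformPotential_add_smul]
  push_cast
  ring_nf
  simp only [Complex.I_sq]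
  ring

end BlochLandau

namespace BlochLandau

open scoped ComplexConjugate
open Filter Topology

/-! ### Density of the range of the covariant Laplacian plus a positive constant -/

/-- The function `x ↦ ⟨u, τ_x φ⟩`, a twisted convolution. -/
noncomputable def twistedConv (β : ℝ) (u : L2) (φ : testFunctions) (x : Plane) : ℂ :=
  inner ℂ u (testToL2 (magneticTranslate β x φ))

lemma inner_testToL2_right (u : L2) (φ : testFunctions) :
    inner ℂ u (testToL2 φ) = ∫ y, conj (u y) * φ.1 y := by
  rw [L2.inner_def]
  refine integral_congr_ae ?_
  filter_upwards [(memLp_test φ).coeFn_toLp] with y h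
  rw [testToL2_apply, h, RCLike.inner_apply, mul_comm]

lemma locallyIntegrable_L2 (u : L2) : LocallyIntegrable u (volume : Measure Plane) :=
  (Lp.memLp u).locallyIntegrable (by norm_num)

lemma norm_twistedConv_le (β : ℝ) (u : L2) (φ : testFunctions) (x : Plane) :
    ‖twistedConv β u φ x‖ ≤ ‖u‖ * ‖testToL2 φ‖ := by
  refine (norm_inner_le_norm _ _).trans_eq ?_
  congr 1
  rw [testToL2_apply, testToL2_apply, Lp.norm_toLp, Lp.norm_toLp]
  congr 1
  rw [eLpNorm_congr_norm_ae (g := fun y => φ.1 (x - y))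
    (.of_forall fun y => norm_magneticTranslate_apply β x y φ)]
  exact eLpNorm_comp_measurePreserving (memLp_test φ).1 (Measure.measurePreserving_sub_left volume x)

/-- For `x` in a bounded set all translates are supported in one ball, on which `u` is integrable.
This provides the dominating function for differentiation and continuity under the integral. -/
lemma exists_bound_magneticTranslate (β : ℝ) (u : L2) (φ : testFunctions) (R : ℝ) :
    ∃ g : Plane → ℝ, Integrable g (volume : Measure Plane) ∧ ∀ x, ‖x‖ ≤ R → ∀ y,
      ‖conj (u y) * (magneticTranslate β x φ).1 y‖ ≤ g y := by
  obtain ⟨C, hC⟩ := φ.2.1.continuous.bounded_above_of_compact_support φ.2.2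
  obtain ⟨R', hR'⟩ := φ.2.2.isCompact.isBounded.exists_norm_le
  have hC0 : 0 ≤ C := (norm_nonneg _).trans (hC 0)
  have hint : IntegrableOn u (Metric.closedBall (0 : Plane) (R + R')) :=
    (locallyIntegrable_L2 u).integrableOn_isCompact (isCompact_closedBall _ _)
  refine ⟨(Metric.closedBall (0 : Plane) (R + R')).indicator fun y => C * ‖u y‖,
    (integrable_indicator_iff measurableSet_closedBall).2 (hint.norm.const_mul C), ?_⟩
  intro x hx y
  rw [norm_mul, RCLike.norm_conj, norm_magneticTranslate_apply]
  by_cases hy : y ∈ Metric.closedBall (0 : Plane) (R + R')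
  · rw [Set.indicator_of_mem hy, mul_comm]
    gcongr
    exact hC _
  · rw [Set.indicator_of_notMem hy]
    have : φ.1 (x - y) = 0 := by
      by_contra h
      have h1 := hR' _ (subset_tsupport _ h)
      refine hy ?_
      rw [mem_closedBall_zero_iff]
      have h2 := norm_sub_le x (x - y)
      rw [sub_sub_cancel] at h2
      linarith
    simp [this]

lemma aestronglyMeasurable_conj_mul_test (u : L2) (φ : testFunctions) :
    AEStronglyMeasurable (fun y => conj (u y) * φ.1 y) (volume : Measure Plane) :=
  (Complex.continuous_conj.comp_aestronglyMeasurable (Lp.memLp u).1).mul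
    φ.2.1.continuous.aestronglyMeasurable

/-- Equivalently, `-i ∂_j - (A_β)_j` in the variable `x` acts on the twisted convolution by
replacing `φ` with `P_j φ`. The potential may be evaluated at `x` instead of `x + t e_j` because its
`j`-th component is constant along `e_j`. -/
lemma hasDerivAt_twistedConv (β : ℝ) (u : L2) (φ : testFunctions) (j : Fin 2) (x : Plane) (t : ℝ) :
    HasDerivAt (fun s : ℝ => twistedConv β u φ (x + s • e j))
      (Complex.I * twistedConv β u (covMomentum β j φ) (x + t • e j) +
        Complex.I * uniformPotential β x j * twistedConv β u φ (x + t • e j)) t := by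
  obtain ⟨g₁, hg₁, hb₁⟩ := exists_bound_magneticTranslate β u φ (‖x‖ + (|t| + 1))
  obtain ⟨g₂, hg₂, hb₂⟩ := exists_bound_magneticTranslate β u (covMomentum β j φ) (‖x‖ + (|t| + 1))
  have hball : ∀ s ∈ Metric.ball t 1, ‖x + s • e j‖ ≤ ‖x‖ + (|t| + 1) := by
    intro s hs
    refine (norm_add_le _ _).trans ?_
    have h1 : ‖s • e j‖ = |s| := by simp [norm_smul]
    have h2 : |s| ≤ |t| + 1 := by
      have h3 := (Metric.mem_ball.1 hs).le
      rw [Real.dist_eq] at h3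
      have h4 := abs_sub_abs_le_abs_sub s t
      linarith
    rw [h1]
    linarith
  have ht := hball t (Metric.mem_ball_self one_pos)
  have i₁ : Integrable (fun y => conj (u y) * (magneticTranslate β (x + t • e j) φ).1 y)
      (volume : Measure Plane) :=
    hg₁.mono' (aestronglyMeasurable_conj_mul_test _ _) (.of_forall (hb₁ _ ht))
  have i₂ : Integrable
      (fun y => conj (u y) * (magneticTranslate β (x + t • e j) (covMomentum β j φ)).1 y)
      (volume : Measure Plane) :=
    hg₂.mono' (aestronglyMeasurable_conj_mul_test _ _) (.of_forall (hb₂ _ ht))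
  simp only [twistedConv, inner_testToL2_right]
  have key := (hasDerivAt_integral_of_dominated_loc_of_deriv_le (μ := (volume : Measure Plane))
    (F := fun s y => conj (u y) * (magneticTranslate β (x + s • e j) φ).1 y)
    (F' := fun s y => Complex.I *
        (conj (u y) * (magneticTranslate β (x + s • e j) (covMomentum β j φ)).1 y) +
      Complex.I * uniformPotential β x j *
        (conj (u y) * (magneticTranslate β (x + s • e j) φ).1 y))
    (bound := fun y => g₂ y + ‖Complex.I * (uniformPotential β x j : ℂ)‖ * g₁ y)
    (Metric.ball_mem_nhds t one_pos)
    (.of_forall fun s => aestronglyMeasurable_conj_mul_test _ _) i₁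
    ((i₂.const_mul _).add (i₁.const_mul _)).1
    (.of_forall fun y s hs => ?_) (hg₂.add (hg₁.const_mul _))
    (.of_forall fun y s hs => ?_)).2
  · rwa [integral_add (i₂.const_mul _) (i₁.const_mul _), integral_const_mul,
      integral_const_mul] at key
  · refine (norm_add_le _ _).trans (add_le_add ?_ ?_)
    · rw [norm_mul, Complex.norm_I, one_mul]
      exact hb₂ _ (hball s hs) y
    · rw [norm_mul]
      gcongr
      exact hb₁ _ (hball s hs) y
  · convert! (hasDerivAt_magneticTranslate β x y j φ s).const_mul (conj (u y)) using 1
    ring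

/-- Joint continuity is needed for the maximum principle and does not follow from differentiability
along coordinate lines. -/
lemma continuous_twistedConv (β : ℝ) (u : L2) (φ : testFunctions) :
    Continuous (twistedConv β u φ) := by
  rw [continuous_iff_continuousAt]
  intro x
  obtain ⟨g, hg, hb⟩ := exists_bound_magneticTranslate β u φ (‖x‖ + 1)
  have : twistedConv β u φ = fun x => ∫ y, conj (u y) * (magneticTranslate β x φ).1 y :=
    funext fun x => inner_testToL2_right _ _
  rw [this]
  refine continuousAt_of_dominated (bound := g)
    (.of_forall fun s => aestronglyMeasurable_conj_mul_test _ _) ?_ hg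
    (.of_forall fun y => ?_)
  · filter_upwards [Metric.ball_mem_nhds x one_pos] with z hz
    refine .of_forall (hb z ?_)
    have h1 := (Metric.mem_ball.1 hz).le
    rw [dist_eq_norm] at h1
    have h2 := norm_le_norm_add_norm_sub' z x
    linarith
  · refine Continuous.continuousAt (continuous_const.mul ?_)
    simp only [magneticTranslate_apply]
    refine (φ.2.1.continuous.comp (by fun_prop)).mul (Complex.continuous_exp.comp
      (continuous_const.mul (Complex.continuous_ofReal.comp ?_)))
    simp only [magneticPhase, uniformPotential]
    simp
    fun_prop

/-- Orthogonality is tested on a translate. Since `P_j` acts on the twisted convolution `v` through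
`φ`, this is the equation `∑ (P_j + 2 (A_β)_j)² v = -l v`, that is, the resolvent equation with
reversed field. -/
lemma twistedConv_laplace {β l : ℝ} {u : L2}
    (hu : ∀ φ, inner ℂ u (testToL2 (covLaplacian β φ) + (l : ℂ) • testToL2 φ) = 0)
    (φ : testFunctions) (x : Plane) :
    ∑ j, (twistedConv β u (covMomentum β j (covMomentum β j φ)) x +
      4 * (uniformPotential β x j : ℂ) * twistedConv β u (covMomentum β j φ) x +
      4 * (uniformPotential β x j : ℂ) ^ 2 * twistedConv β u φ x) = - l * twistedConv β u φ x := by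
  have h := hu (magneticTranslate β x φ)
  rw [covLaplacian_apply, covMomentum_sq_magneticTranslate, covMomentum_sq_magneticTranslate] at h
  simp only [map_add, map_smul, inner_add_right, inner_smul_right] at h
  rw [Fin.sum_univ_two]
  simp only [twistedConv]
  linear_combination h

lemma twistedConv_eq_zero {β l : ℝ} (hl : 0 < l) {u : L2}
    (hu : ∀ φ, inner ℂ u (testToL2 (covLaplacian β φ) + (l : ℂ) • testToL2 φ) = 0)
    (φ : testFunctions) (x : Plane) : twistedConv β u φ x = 0 := by
  set v := twistedConv β u φ with hv
  set v₁ : Fin 2 → Plane → ℂ := fun j => twistedConv β u (covMomentum β j φ) with hv₁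
  set v₂ : Fin 2 → Plane → ℂ :=
    fun j => twistedConv β u (covMomentum β j (covMomentum β j φ)) with hv₂
  have d₀ (j : Fin 2) (x : Plane) (t : ℝ) : HasDerivAt (fun s : ℝ => v (x + s • e j))
      (Complex.I * v₁ j (x + t • e j) + Complex.I * uniformPotential β x j * v (x + t • e j)) t :=
    hasDerivAt_twistedConv β u φ j x t
  have d₁ (j : Fin 2) (x : Plane) (t : ℝ) : HasDerivAt (fun s : ℝ => v₁ j (x + s • e j))
      (Complex.I * v₂ j (x + t • e j) + Complex.I * uniformPotential β x j * v₁ j (x + t • e j)) t :=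
    hasDerivAt_twistedConv β u (covMomentum β j φ) j x t
  have hconj {f : ℝ → ℂ} {f' : ℂ} {t : ℝ} (h : HasDerivAt f f' t) :
      HasDerivAt (fun s => conj (f s)) (conj f') t :=
    Complex.conjCLE.toContinuousLinearMap.hasFDerivAt.comp_hasDerivAt t h
  have hre {f : ℝ → ℂ} {f' : ℂ} {t : ℝ} (h : HasDerivAt f f' t) :
      HasDerivAt (fun s => (f s).re) f'.re t :=
    Complex.reCLM.hasFDerivAt.comp_hasDerivAt t h
  have key : ∀ x, ‖v x‖ ^ 2 ≤ 0 := by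
    -- The functions `w₁` and `w₂` are the first and second partial derivatives of `|v|²`. The
    -- potential cancels from them because `|v|²` is gauge invariant.
    refine nonpos_of_laplacian_ge (l := 2 * l) (C := (‖u‖ * ‖testToL2 φ‖) ^ 2)
      (w₁ := fun j x => (2 * (Complex.I * (conj (v x) * v₁ j x))).re)
      (w₂ := fun j x => 2 * ‖v₁ j x‖ ^ 2 - (2 * (conj (v x) * v₂ j x)).re)
      (by positivity) ((continuous_twistedConv β u φ).norm.pow 2)
      (fun x => by
        have := norm_twistedConv_le β u φ x
        gcongr) ?_ ?_ ?_
    · intro j x t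
      have h1 := hre ((hconj (d₀ j x t)).mul (d₀ j x t))
      have h2 : (fun s : ℝ => ‖v (x + s • e j)‖ ^ 2) = fun s : ℝ =>
          (((fun s : ℝ => conj (v (x + s • e j))) * fun s : ℝ => v (x + s • e j)) s).re := by
        funext s
        rw [Pi.mul_apply, Complex.conj_mul', ← Complex.ofReal_pow, Complex.ofReal_re]
      rw [h2]
      convert! h1 using 1
      simp only [map_add, map_mul, Complex.conj_I, Complex.conj_ofReal, Complex.add_re,
        Complex.mul_re, Complex.mul_im, Complex.conj_re, Complex.conj_im, Complex.I_re,
        Complex.I_im, Complex.add_im, Complex.neg_re, Complex.neg_im, Complex.ofReal_re,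
        Complex.ofReal_im, Complex.re_ofNat, Complex.im_ofNat]
      ring
    · intro j x t
      have h1 := hre (((hconj (d₀ j x t)).mul (d₁ j x t)).const_mul (2 * Complex.I))
      have h2 : (fun s : ℝ => (2 * (Complex.I * (conj (v (x + s • e j)) * v₁ j (x + s • e j)))).re) =
          fun s : ℝ => (2 * Complex.I * ((fun s : ℝ => conj (v (x + s • e j))) *
            fun s : ℝ => v₁ j (x + s • e j)) s).re := by
        funext s
        rw [Pi.mul_apply, mul_assoc]
      rw [h2]
      convert! h1 using 1
      rw [← Complex.normSq_eq_norm_sq, Complex.normSq_apply]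
      simp only [map_add, map_mul, Complex.conj_I, Complex.conj_ofReal, Complex.add_re,
        Complex.mul_re, Complex.mul_im, Complex.conj_re, Complex.conj_im, Complex.I_re,
        Complex.I_im, Complex.add_im, Complex.neg_re, Complex.neg_im, Complex.ofReal_re,
        Complex.ofReal_im, Complex.re_ofNat, Complex.im_ofNat]
      ring
    · intro x
      have h := twistedConv_laplace hu φ x
      rw [Fin.sum_univ_two] at h
      have h1 := congrArg Complex.re h
      have h2 := congrArg Complex.im h
      change (v₂ 0 x + 4 * (uniformPotential β x 0 : ℂ) * v₁ 0 x +
        4 * (uniformPotential β x 0 : ℂ) ^ 2 * v x + (v₂ 1 x +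
        4 * (uniformPotential β x 1 : ℂ) * v₁ 1 x +
        4 * (uniformPotential β x 1 : ℂ) ^ 2 * v x)).re = (-l * v x : ℂ).re at h1
      change (v₂ 0 x + 4 * (uniformPotential β x 0 : ℂ) * v₁ 0 x +
        4 * (uniformPotential β x 0 : ℂ) ^ 2 * v x + (v₂ 1 x +
        4 * (uniformPotential β x 1 : ℂ) * v₁ 1 x +
        4 * (uniformPotential β x 1 : ℂ) ^ 2 * v x)).im = (-l * v x : ℂ).im at h2
      simp only [← Complex.normSq_eq_norm_sq, Complex.normSq_apply]
      simp only [pow_two, Complex.add_re,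
        Complex.mul_re, Complex.mul_im, Complex.conj_re, Complex.conj_im,
        Complex.add_im, Complex.neg_re, Complex.neg_im, Complex.ofReal_re,
        Complex.ofReal_im, Complex.re_ofNat, Complex.im_ofNat] at h1 h2 ⊢
      generalize uniformPotential β x 0 = α at *
      generalize uniformPotential β x 1 = γ at *
      -- By the equation, `Δ|v|² = 2 ∑ |v₁ j + 2 (A_β)_j v|² + 2l |v|²`. These four squares are the
      -- real and imaginary parts of the terms of the sum.
      have e1 := sq_nonneg ((v₁ 0 x).re + 2 * α * (v x).re)
      have e2 := sq_nonneg ((v₁ 0 x).im + 2 * α * (v x).im)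
      have e3 := sq_nonneg ((v₁ 1 x).re + 2 * γ * (v x).re)
      have e4 := sq_nonneg ((v₁ 1 x).im + 2 * γ * (v x).im)
      have e5 := congrArg (fun z => (v x).re * z) h1
      have e6 := congrArg (fun z => (v x).im * z) h2
      linarith
  have h0 := key x
  have h1 : ‖v x‖ ^ 2 = 0 := le_antisymm h0 (by positivity)
  simpa using h1

/-- The range of the covariant Laplacian plus a positive constant on test functions is dense. -/
lemma eq_zero_of_inner_covLaplacian_add_eq_zero {β l : ℝ} (hl : 0 < l) {u : L2}
    (hu : ∀ φ, inner ℂ u (testToL2 (covLaplacian β φ) + (l : ℂ) • testToL2 φ) = 0) : u = 0 := by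
  refine denseRange_testToL2.eq_zero_of_inner_left (𝕜 := ℂ) fun φ => ?_
  -- The reflection is undone by the one in `magneticTranslate`, whose phase vanishes at `x = 0`.
  -- Hence the value at `0` is `⟨u, φ⟩`.
  let ψ : testFunctions := ⟨fun y => φ.1 (-y), φ.2.1.comp contDiff_neg,
    φ.2.2.comp_homeomorph (Homeomorph.neg Plane)⟩
  have h := twistedConv_eq_zero hl hu ψ 0
  have h1 : magneticTranslate β 0 ψ = φ := by
    apply Subtype.ext
    funext y
    rw [magneticTranslate_apply, magneticPhase_zero_left]
    simp [ψ]
  rwa [twistedConv, h1] at h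

end BlochLandau

namespace BlochLandau

open scoped ComplexConjugate ENNReal NNReal
open Filter Topology

/-! ### Uniformly locally square integrable potentials -/

/-- The half-open unit square with upper right corner `y`. -/
def unitBox (y : Plane) : Set Plane := {z | ∀ i, y i - z i ∈ Set.Ioc (0 : ℝ) 1}

lemma measurableSet_unitBox (y : Plane) : MeasurableSet (unitBox y) := by
  have : unitBox y = ⋂ i, (fun z : Plane => y i - z i) ⁻¹' Set.Ioc (0 : ℝ) 1 := by
    ext z; simp [unitBox]
  rw [this]
  exact MeasurableSet.iInter fun i => (Continuous.measurable (by fun_prop)) measurableSet_Ioc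

lemma unitBox_subset_closedBall (y : Plane) : unitBox y ⊆ Metric.closedBall y 2 := by
  intro z hz
  have h : ‖y - z‖ ^ 2 ≤ 2 ^ 2 := by
    rw [EuclideanSpace.norm_sq_eq, Fin.sum_univ_two]
    have h0 := hz 0
    have h1 := hz 1
    simp only [PiLp.sub_apply, Real.norm_eq_abs, sq_abs]
    nlinarith [h0.1, h0.2, h1.1, h1.2]
  rw [Metric.mem_closedBall, dist_comm, dist_eq_norm]
  exact le_of_sq_le_sq h (by norm_num)

/-- `V` is square integrable on unit squares, uniformly in their position. -/
def IsUniformlyLocallyL2 (V : Plane → ℝ) : Prop :=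
  ∃ N : ℝ≥0, ∀ y, eLpNorm V 2 (volume.restrict (unitBox y)) ≤ N

lemma IsLocallyL2.aestronglyMeasurable {V : Plane → ℝ} (hV : IsLocallyL2 V) :
    AEStronglyMeasurable V (volume : Measure Plane) := by
  have h : AEStronglyMeasurable V
      (volume.restrict (⋃ n : ℕ, Metric.closedBall (0 : Plane) n)) :=
    AEStronglyMeasurable.iUnion fun n => (hV _ (isCompact_closedBall _ _)).1
  rwa [Metric.iUnion_closedBall_nat, Measure.restrict_univ] at h

lemma IsUniformlyLocallyL2.add {V W : Plane → ℝ} (hV : IsUniformlyLocallyL2 V)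
    (hW : IsUniformlyLocallyL2 W) (mV : AEStronglyMeasurable V (volume : Measure Plane))
    (mW : AEStronglyMeasurable W (volume : Measure Plane)) :
    IsUniformlyLocallyL2 (fun r => V r + W r) := by
  obtain ⟨N, hN⟩ := hV
  obtain ⟨M, hM⟩ := hW
  refine ⟨N + M, fun y => ?_⟩
  rw [ENNReal.coe_add]
  exact (eLpNorm_add_le mV.restrict mW.restrict (by norm_num)).trans (add_le_add (hN y) (hM y))

lemma isUniformlyLocallyL2_of_bounded {W : Plane → ℝ} {C : ℝ} (hW : ∀ x, ‖W x‖ ≤ C) :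
    IsUniformlyLocallyL2 W := by
  have hfin : (volume (Metric.closedBall (0 : Plane) 2)) ^ ((2 : ℝ≥0∞).toReal⁻¹) *
      ENNReal.ofReal C ≠ ⊤ :=
    ENNReal.mul_ne_top (ENNReal.rpow_ne_top_of_nonneg (by simp)
      (isCompact_closedBall _ _).measure_lt_top.ne) ENNReal.ofReal_ne_top
  lift (volume (Metric.closedBall (0 : Plane) 2)) ^ ((2 : ℝ≥0∞).toReal⁻¹) *
      ENNReal.ofReal C to ℝ≥0 using hfin with N hN
  refine ⟨N, fun y => ?_⟩
  rw [hN]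
  refine (eLpNorm_le_of_ae_bound (.of_forall hW)).trans ?_
  gcongr ?_ ^ _ * _
  rw [Measure.restrict_apply_univ, ← Measure.addHaar_closedBall_center volume y]
  exact measure_mono (unitBox_subset_closedBall y)

/-- A lattice translation brings the corner of a square into the fundamental cell, and all such
squares lie in one fixed ball. -/
lemma isUniformlyLocallyL2_of_periodic {a b : Plane} (hab : 0 < wedge a b) {V : Plane → ℝ}
    (hp : IsLatticePeriodic a b V) (hV : IsLocallyL2 V) : IsUniformlyLocallyL2 V := by
  have hbdd : ∃ R, ∀ y ∈ cell a b, unitBox y ⊆ Metric.closedBall 0 R := by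
    refine ⟨‖a‖ + ‖b‖ + 2, ?_⟩
    rintro y ⟨l₁, h₁, l₂, h₂, rfl⟩ z hz
    have hz' := unitBox_subset_closedBall _ hz
    rw [Metric.mem_closedBall, dist_eq_norm] at hz'
    rw [mem_closedBall_zero_iff]
    have e1 : ‖l₁ • a‖ ≤ ‖a‖ := by
      rw [norm_smul, Real.norm_of_nonneg h₁.1]
      exact mul_le_of_le_one_left (norm_nonneg _) h₁.2
    have e2 : ‖l₂ • b‖ ≤ ‖b‖ := by
      rw [norm_smul, Real.norm_of_nonneg h₂.1]
      exact mul_le_of_le_one_left (norm_nonneg _) h₂.2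
    have e3 := norm_add_le (l₁ • a) (l₂ • b)
    have e4 := norm_le_norm_add_norm_sub' z (l₁ • a + l₂ • b)
    linarith
  obtain ⟨R, hR⟩ := hbdd
  have hfin := (hV _ (isCompact_closedBall (0 : Plane) R)).2.ne
  lift eLpNorm V 2 (volume.restrict (Metric.closedBall (0 : Plane) R)) to ℝ≥0 using hfin with N hN
  refine ⟨N, fun y => ?_⟩
  rw [hN]
  set n : ℤ × ℤ := (⌊(y 0 * b 1 - y 1 * b 0) / wedge a b⌋, ⌊(a 0 * y 1 - a 1 * y 0) / wedge a b⌋)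
  have hy := exists_mem_cell hab y
  have hpre : (fun r => r - latticeVec a b n) ⁻¹' unitBox (y - latticeVec a b n) = unitBox y := by
    ext z
    simp only [unitBox, Set.mem_preimage, Set.mem_ofPred_eq, PiLp.sub_apply,
      sub_sub_sub_cancel_right]
  have h := (measurePreserving_sub_right (volume : Measure Plane)
    (latticeVec a b n)).restrict_preimage (measurableSet_unitBox (y - latticeVec a b n))
  rw [hpre] at h
  have hcomp : V ∘ (fun r => r - latticeVec a b n) = V := by
    funext r
    have := hp n (r - latticeVec a b n)
    rw [sub_add_cancel] at this
    exact this.symm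
  have h2 := eLpNorm_comp_measurePreserving (p := 2) (g := V)
    (hV.aestronglyMeasurable.restrict) h
  rw [hcomp] at h2
  rw [h2]
  exact eLpNorm_mono_measure _ (Measure.restrict_mono (hR _ hy) le_rfl)

/-! ### A covariant Sobolev inequality -/

lemma fderiv_eq_covMomentum (β : ℝ) (j : Fin 2) (φ : testFunctions) (r : Plane) :
    fderiv ℝ φ.1 r (e j) =
      Complex.I * (covMomentum β j φ).1 r + Complex.I * uniformPotential β r j * φ.1 r := by
  rw [covMomentum_apply]
  ring_nf
  simp

/-- The derivative of `conj φ * ψ` involves only covariant derivatives, as the potential terms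
cancel. Keeping two functions allows the inequality to be iterated on the products that it produces.
-/
lemma norm_mul_norm_le_integral (β : ℝ) (j : Fin 2) (φ ψ : testFunctions) (x : Plane) :
    ‖φ.1 x‖ * ‖ψ.1 x‖ ≤ ∫ t in (0 : ℝ)..1, (‖φ.1 (x + t • e j)‖ * ‖ψ.1 (x + t • e j)‖ +
      (‖(covMomentum β j φ).1 (x + t • e j)‖ * ‖ψ.1 (x + t • e j)‖ +
        ‖φ.1 (x + t • e j)‖ * ‖(covMomentum β j ψ).1 (x + t • e j)‖)) := by
  have hconj {f : ℝ → ℂ} {f' : ℂ} {t : ℝ} (h : HasDerivAt f f' t) :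
      HasDerivAt (fun s => conj (f s)) (conj f') t :=
    Complex.conjCLE.toContinuousLinearMap.hasFDerivAt.comp_hasDerivAt t h
  have hc (χ : testFunctions) : Continuous fun t : ℝ => χ.1 (x + t • e j) :=
    χ.2.1.continuous.comp (by fun_prop)
  have hcc (χ : testFunctions) : Continuous fun t : ℝ => conj (χ.1 (x + t • e j)) :=
    Complex.continuous_conj.comp (hc χ)
  have hd (χ : testFunctions) (t : ℝ) := hasDerivAt_comp_line
    (χ.2.1.differentiable (by simp)) x (e j) t
  simp only [fderiv_eq_covMomentum β] at hd
  set g : ℝ → ℂ := fun t => conj (φ.1 (x + t • e j)) * ψ.1 (x + t • e j) with hg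
  set g' : ℝ → ℂ := fun t =>
    -Complex.I * (conj ((covMomentum β j φ).1 (x + t • e j)) * ψ.1 (x + t • e j)) +
      Complex.I * (conj (φ.1 (x + t • e j)) * (covMomentum β j ψ).1 (x + t • e j)) with hg'
  have hgd : ∀ t, HasDerivAt g (g' t) t := by
    intro t
    convert! (hconj (hd φ t)).mul (hd ψ t) using 1
    simp only [hg', map_add, map_mul, Complex.conj_I, Complex.conj_ofReal]
    ring
  have hgc : Continuous g := (hcc φ).mul (hc ψ)
  have hgc' : Continuous g' := (continuous_const.mul ((hcc _).mul (hc _))).add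
    (continuous_const.mul ((hcc _).mul (hc _)))
  -- The weight `t - 1` vanishes at `1`, equals `-1` at `0` and has modulus at most one, so
  -- integrating gives `g 0` with no boundary term at `1`.
  have hh : ∀ t, HasDerivAt (fun t : ℝ => ((t - 1 : ℝ) : ℂ) * g t)
      (g t + ((t - 1 : ℝ) : ℂ) * g' t) t := by
    intro t
    have h1 : HasDerivAt (fun t : ℝ => ((t - 1 : ℝ) : ℂ)) (1 : ℂ) t := by
      simpa using ((hasDerivAt_id t).sub_const 1).ofReal_comp
    simpa using h1.fun_mul (hgd t)
  have hcont : Continuous fun t : ℝ => g t + ((t - 1 : ℝ) : ℂ) * g' t :=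
    hgc.add ((Complex.continuous_ofReal.comp (by fun_prop)).mul hgc')
  have h0 : ∫ t in (0 : ℝ)..1, (g t + ((t - 1 : ℝ) : ℂ) * g' t) = g 0 := by
    rw [intervalIntegral.integral_eq_sub_of_hasDerivAt (fun t _ => hh t)
      (hcont.intervalIntegrable _ _)]
    simp
  have h1 : ‖φ.1 x‖ * ‖ψ.1 x‖ = ‖g 0‖ := by
    simp [hg]
  rw [h1, ← h0]
  refine intervalIntegral.norm_integral_le_of_norm_le zero_le_one ?_
    (Continuous.intervalIntegrable ?_ _ _)
  · refine .of_forall fun t ht => ?_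
    refine (norm_add_le _ _).trans (add_le_add ?_ ?_)
    · rw [hg, norm_mul, RCLike.norm_conj]
    · rw [norm_mul]
      have h2 : ‖((t - 1 : ℝ) : ℂ)‖ ≤ 1 := by
        rw [Complex.norm_real, Real.norm_eq_abs, abs_le]
        constructor <;> linarith [ht.1, ht.2]
      refine (mul_le_of_le_one_left (norm_nonneg _) h2).trans ?_
      refine (norm_add_le _ _).trans_eq ?_
      simp only [norm_mul, norm_neg, Complex.norm_I, one_mul, RCLike.norm_conj]
  · exact ((hc φ).norm.mul (hc ψ).norm).add (((hc _).norm.mul (hc _).norm).add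
      ((hc _).norm.mul (hc _).norm))

lemma ofReal_intervalIntegral_eq {f : ℝ → ℝ} (hf : Continuous f) (h0 : ∀ t, 0 ≤ f t) :
    ENNReal.ofReal (∫ t in (0 : ℝ)..1, f t) = ∫⁻ t in Set.Ioc (0 : ℝ) 1, ENNReal.ofReal (f t) := by
  rw [intervalIntegral.integral_of_le zero_le_one, ofReal_integral_eq_lintegral_ofReal
    (hf.integrableOn_Ioc) (.of_forall h0)]

/-- The energy density controlling `|φ|²` in the covariant Sobolev inequality. -/
noncomputable def sobolevDensity (β δ : ℝ) (φ : testFunctions) (x : Plane) : ℝ :=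
  (3 + δ⁻¹) * ‖φ.1 x‖ ^ 2 + 2 * ‖(covMomentum β 0 φ).1 x‖ ^ 2 +
    2 * ‖(covMomentum β 1 φ).1 x‖ ^ 2 + δ * ‖(covMomentum β 1 (covMomentum β 0 φ)).1 x‖ ^ 2

lemma sobolevDensity_nonneg (β : ℝ) {δ : ℝ} (hδ : 0 < δ) (φ : testFunctions) (x : Plane) :
    0 ≤ sobolevDensity β δ φ x := by
  unfold sobolevDensity; positivity

lemma continuous_sobolevDensity (β δ : ℝ) (φ : testFunctions) :
    Continuous (sobolevDensity β δ φ) := by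
  have h (χ : testFunctions) : Continuous χ.1 := χ.2.1.continuous
  have h0 := h φ
  have h1 := h (covMomentum β 0 φ)
  have h2 := h (covMomentum β 1 φ)
  have h3 := h (covMomentum β 1 (covMomentum β 0 φ))
  unfold sobolevDensity
  fun_prop

lemma norm_sq_le_iterated_lintegral (β : ℝ) {δ : ℝ} (hδ : 0 < δ) (φ : testFunctions) (x : Plane) :
    ENNReal.ofReal (‖φ.1 x‖ ^ 2) ≤ ∫⁻ s in Set.Ioc (0 : ℝ) 1, ∫⁻ t in Set.Ioc (0 : ℝ) 1,
      ENNReal.ofReal (sobolevDensity β δ φ (x + s • e 0 + t • e 1)) := by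
  have hc (χ : testFunctions) (x v : Plane) : Continuous fun t : ℝ => ‖χ.1 (x + t • v)‖ :=
    (χ.2.1.continuous.comp (by fun_prop)).norm
  set P := covMomentum β 0 φ with hP
  set Q := covMomentum β 1 φ with hQ
  set R := covMomentum β 1 (covMomentum β 0 φ) with hR
  have h1 := norm_mul_norm_le_integral β 0 φ φ x
  rw [← pow_two] at h1
  refine (ENNReal.ofReal_le_ofReal h1).trans ?_
  have c0 : Continuous fun t : ℝ => (‖φ.1 (x + t • e 0)‖ * ‖φ.1 (x + t • e 0)‖ +
      (‖P.1 (x + t • e 0)‖ * ‖φ.1 (x + t • e 0)‖ +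
        ‖φ.1 (x + t • e 0)‖ * ‖P.1 (x + t • e 0)‖)) :=
    ((hc _ _ _).mul (hc _ _ _)).add (((hc _ _ _).mul (hc _ _ _)).add
      ((hc _ _ _).mul (hc _ _ _)))
  rw [ofReal_intervalIntegral_eq c0 (fun t => by positivity)]
  refine lintegral_mono fun s => ?_
  set y := x + s • e 0 with hy
  set f₁ : ℝ → ℝ := fun t => ‖φ.1 (y + t • e 1)‖ * ‖φ.1 (y + t • e 1)‖ +
      (‖Q.1 (y + t • e 1)‖ * ‖φ.1 (y + t • e 1)‖ +
        ‖φ.1 (y + t • e 1)‖ * ‖Q.1 (y + t • e 1)‖) with hf₁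
  set f₂ : ℝ → ℝ := fun t => ‖φ.1 (y + t • e 1)‖ * ‖P.1 (y + t • e 1)‖ +
      (‖Q.1 (y + t • e 1)‖ * ‖P.1 (y + t • e 1)‖ +
        ‖φ.1 (y + t • e 1)‖ * ‖R.1 (y + t • e 1)‖) with hf₂
  have h2 : ‖φ.1 y‖ * ‖φ.1 y‖ ≤ ∫ t in (0 : ℝ)..1, f₁ t := norm_mul_norm_le_integral β 1 φ φ y
  have h3 : ‖φ.1 y‖ * ‖P.1 y‖ ≤ ∫ t in (0 : ℝ)..1, f₂ t := norm_mul_norm_le_integral β 1 φ P y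
  have c1 : Continuous f₁ :=
    ((hc _ _ _).mul (hc _ _ _)).add (((hc _ _ _).mul (hc _ _ _)).add
      ((hc _ _ _).mul (hc _ _ _)))
  have c2 : Continuous fun t => 2 * f₂ t :=
    continuous_const.mul (((hc _ _ _).mul (hc _ _ _)).add (((hc _ _ _).mul (hc _ _ _)).add
      ((hc _ _ _).mul (hc _ _ _))))
  have c3 : Continuous fun t : ℝ => sobolevDensity β δ φ (y + t • e 1) :=
    (continuous_sobolevDensity β δ φ).comp (by fun_prop)
  rw [← ofReal_intervalIntegral_eq c3 (fun t => sobolevDensity_nonneg β hδ φ _)]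
  refine ENNReal.ofReal_le_ofReal ?_
  have h4 : ‖φ.1 y‖ * ‖φ.1 y‖ + (‖P.1 y‖ * ‖φ.1 y‖ + ‖φ.1 y‖ * ‖P.1 y‖) =
      ‖φ.1 y‖ * ‖φ.1 y‖ + 2 * (‖φ.1 y‖ * ‖P.1 y‖) := by ring
  rw [h4]
  refine (add_le_add h2 (mul_le_mul_of_nonneg_left h3 zero_le_two)).trans ?_
  rw [← intervalIntegral.integral_const_mul, ← intervalIntegral.integral_add
    (c1.intervalIntegrable _ _) (c2.intervalIntegrable _ _)]
  refine intervalIntegral.integral_mono_on zero_le_one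
    ((c1.add c2).intervalIntegrable _ _) (c3.intervalIntegrable _ _)
    fun t _ => ?_
  simp only [hf₁, hf₂, sobolevDensity, ← hP, ← hQ]
  generalize y + t • e 1 = z
  have h5 : 2 * (‖φ.1 z‖ * ‖R.1 z‖) ≤ δ⁻¹ * ‖φ.1 z‖ ^ 2 + δ * ‖R.1 z‖ ^ 2 := by
    have h6 : 0 ≤ δ⁻¹ * (‖φ.1 z‖ - δ * ‖R.1 z‖) ^ 2 := by positivity
    have h7 : δ⁻¹ * (‖φ.1 z‖ - δ * ‖R.1 z‖) ^ 2 =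
        δ⁻¹ * ‖φ.1 z‖ ^ 2 + δ * ‖R.1 z‖ ^ 2 - 2 * (‖φ.1 z‖ * ‖R.1 z‖) := by
      field_simp
      ring
    linarith
  -- The products `2|φ||Q|`, `2|φ||P|` and `2|P||Q|` are split evenly, which gives the coefficients
  -- `3`, `2`, `2` of `sobolevDensity`. Only `|φ||R|` is split with the weight `δ`.
  nlinarith [sq_nonneg (‖φ.1 z‖ - ‖Q.1 z‖), sq_nonneg (‖φ.1 z‖ - ‖P.1 z‖),
    sq_nonneg (‖P.1 z‖ - ‖Q.1 z‖)]

/-- The square with lower left corner `x` consists of the `y` whose `unitBox` contains `x`. In this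
form Tonelli's theorem can exchange `x` and `y`. -/
lemma iterated_lintegral_eq {f : Plane → ℝ≥0∞} (hf : Measurable f) (x : Plane) :
    ∫⁻ s in Set.Ioc (0 : ℝ) 1, ∫⁻ t in Set.Ioc (0 : ℝ) 1, f (x + s • e 0 + t • e 1) =
      ∫⁻ y, (unitBox y).indicator (fun _ => f y) x := by
  let E : ℝ × ℝ → Plane := fun p => x + WithLp.toLp 2 ![p.1, p.2]
  have hE : MeasurePreserving E :=
    (measurePreserving_add_left volume x).comp ((PiLp.volume_preserving_toLp (Fin 2)).comp
      ((volume_preserving_finTwoArrow ℝ).symm _))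
  have hbox : MeasurableSet {y : Plane | x ∈ unitBox y} := by
    have : {y : Plane | x ∈ unitBox y} = ⋂ i, (fun y : Plane => y i - x i) ⁻¹' Set.Ioc (0 : ℝ) 1 := by
      ext z; simp [unitBox]
    rw [this]
    exact MeasurableSet.iInter fun i => (Continuous.measurable (by fun_prop)) measurableSet_Ioc
  have h1 : ∀ p : ℝ × ℝ, x + p.1 • e 0 + p.2 • e 1 = E p := by
    intro p
    ext i
    fin_cases i <;> simp [E]
  have h2 : E ⁻¹' {y : Plane | x ∈ unitBox y} = Set.Ioc (0 : ℝ) 1 ×ˢ Set.Ioc (0 : ℝ) 1 := by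
    ext p
    simp [E, unitBox, Fin.forall_fin_two, add_comm (x _)]
  rw [← setLIntegral_prod (fun p : ℝ × ℝ => f (x + p.1 • e 0 + p.2 • e 1))
    (Measurable.aemeasurable (by simp only [h1]; exact hf.comp hE.measurable))]
  simp only [h1]
  rw [← h2, ← Measure.volume_eq_prod, hE.setLIntegral_comp_preimage hbox hf,
    ← lintegral_indicator hbox]
  rfl

lemma integral_norm_sq_test (φ : testFunctions) : ∫ r, ‖φ.1 r‖ ^ 2 = ‖testToL2 φ‖ ^ 2 := by
  have h : ((‖testToL2 φ‖ ^ 2 : ℝ) : ℂ) = ((∫ r, ‖φ.1 r‖ ^ 2 : ℝ) : ℂ) := by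
    rw [← integral_complex_ofReal]
    have h1 := inner_testToL2 φ φ
    rw [inner_self_eq_norm_sq_to_K] at h1
    push_cast
    refine Eq.trans h1 (integral_congr_ae (.of_forall fun r => ?_))
    simp only [Complex.conj_mul']
  exact_mod_cast h.symm

lemma lintegral_sobolevDensity (β : ℝ) {δ : ℝ} (hδ : 0 < δ) (φ : testFunctions) :
    ∫⁻ y, ENNReal.ofReal (sobolevDensity β δ φ y) = ENNReal.ofReal ((3 + δ⁻¹) * ‖testToL2 φ‖ ^ 2 +
      2 * ‖testToL2 (covMomentum β 0 φ)‖ ^ 2 + 2 * ‖testToL2 (covMomentum β 1 φ)‖ ^ 2 +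
      δ * ‖testToL2 (covMomentum β 1 (covMomentum β 0 φ))‖ ^ 2) := by
  have hi (χ : testFunctions) : Integrable (fun r => ‖χ.1 r‖ ^ 2) (volume : Measure Plane) :=
    (memLp_test χ).norm.integrable_sq
  have hi1 := (hi φ).const_mul (3 + δ⁻¹)
  have hi2 := (hi (covMomentum β 0 φ)).const_mul 2
  have hi3 := (hi (covMomentum β 1 φ)).const_mul 2
  have hi4 := (hi (covMomentum β 1 (covMomentum β 0 φ))).const_mul δ
  have hi12 := hi1.fun_add hi2
  have hi123 := hi12.fun_add hi3
  have hi0 : Integrable (sobolevDensity β δ φ) (volume : Measure Plane) := hi123.fun_add hi4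
  rw [← ofReal_integral_eq_lintegral_ofReal hi0
    (.of_forall fun x => sobolevDensity_nonneg β hδ φ x)]
  simp only [sobolevDensity]
  rw [integral_add hi123 hi4, integral_add hi12 hi3,
    integral_add hi1 hi2, integral_const_mul, integral_const_mul, integral_const_mul,
    integral_const_mul]
  simp only [integral_norm_sq_test]

lemma enorm_sq_toLp {f : Plane → ℂ} (hf : MemLp f 2 (volume : Measure Plane)) :
    ENNReal.ofReal (‖hf.toLp f‖ ^ 2) = ∫⁻ x, ‖f x‖ₑ ^ 2 := by
  rw [Lp.norm_toLp, ENNReal.ofReal_pow ENNReal.toReal_nonneg, ENNReal.ofReal_toReal hf.2.ne]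
  have := eLpNorm_nnreal_pow_eq_lintegral (f := f) (μ := (volume : Measure Plane)) (p := 2)
    (by norm_num)
  simpa using this

/-- Multiplication by a uniformly locally square integrable potential is form-bounded by the
second order covariant Sobolev norm, with a small coefficient on the second derivatives. -/
lemma exists_norm_potential_mul_le {V : Plane → ℝ} (hV : IsLocallyL2 V)
    (hVu : IsUniformlyLocallyL2 V) : ∃ N : ℝ, 0 ≤ N ∧ ∀ (β δ : ℝ), 0 < δ → ∀ φ : testFunctions,
      ‖(memLp_potential_mul hV φ.2.1.continuous φ.2.2).toLp _‖ ^ 2 ≤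
        N * ((3 + δ⁻¹) * ‖testToL2 φ‖ ^ 2 +
      2 * ‖testToL2 (covMomentum β 0 φ)‖ ^ 2 + 2 * ‖testToL2 (covMomentum β 1 φ)‖ ^ 2 +
      δ * ‖testToL2 (covMomentum β 1 (covMomentum β 0 φ))‖ ^ 2) := by
  obtain ⟨N, hN⟩ := hVu
  have hN' : ∀ y, ∫⁻ z in unitBox y, ‖V z‖ₑ ^ 2 ≤ (N : ℝ≥0∞) ^ 2 := by
    intro y
    have := eLpNorm_nnreal_pow_eq_lintegral (f := V) (μ := volume.restrict (unitBox y)) (p := 2)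
      (by norm_num)
    simp only [NNReal.coe_ofNat, ENNReal.rpow_ofNat, ENNReal.coe_ofNat] at this
    rw [← this]
    gcongr
    exact hN y
  refine ⟨(N : ℝ) ^ 2, by positivity, fun β δ hδ φ => ?_⟩
  set G := fun y => ENNReal.ofReal (sobolevDensity β δ φ y) with hG
  have hGm : Measurable G := (continuous_sobolevDensity β δ φ).measurable.ennreal_ofReal
  have hVm : AEMeasurable (fun x => ‖V x‖ₑ ^ 2) (volume : Measure Plane) :=
    hV.aestronglyMeasurable.enorm.pow_const 2
  have hset : MeasurableSet {p : Plane × Plane | p.1 ∈ unitBox p.2} := by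
    have : {p : Plane × Plane | p.1 ∈ unitBox p.2} =
        ⋂ i, (fun p : Plane × Plane => p.2 i - p.1 i) ⁻¹' Set.Ioc (0 : ℝ) 1 := by
      ext z; simp [unitBox]
    rw [this]
    exact MeasurableSet.iInter fun i => (Continuous.measurable (by fun_prop)) measurableSet_Ioc
  have hjoint : AEMeasurable (Function.uncurry fun x y : Plane =>
      ‖V x‖ₑ ^ 2 * (unitBox y).indicator (fun _ => G y) x)
      ((volume : Measure Plane).prod volume) := by
    refine (hVm.comp_quasiMeasurePreserving Measure.quasiMeasurePreserving_fst).mul ?_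
    have : Measurable ({p : Plane × Plane | p.1 ∈ unitBox p.2}.indicator fun p => G p.2) :=
      (hGm.comp measurable_snd).indicator hset
    exact this.aemeasurable
  -- Bound `|φ(x)|²` by the integral of `G` over a unit square and exchange the integrals. The inner
  -- integral of `|V|²` over `unitBox y` is then at most `N²`.
  have key : ∫⁻ x, ‖(V x : ℂ) * φ.1 x‖ₑ ^ 2 ≤ (N : ℝ≥0∞) ^ 2 * ∫⁻ y, G y := by
    calc ∫⁻ x, ‖(V x : ℂ) * φ.1 x‖ₑ ^ 2
        ≤ ∫⁻ x, ∫⁻ y, ‖V x‖ₑ ^ 2 * (unitBox y).indicator (fun _ => G y) x := by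
          refine lintegral_mono fun x => ?_
          have hm : Measurable fun y => (unitBox y).indicator (fun _ => G y) x := by
            have : MeasurableSet {y : Plane | x ∈ unitBox y} := measurable_prodMk_left hset
            exact hGm.indicator this
          rw [lintegral_const_mul _ hm, ← iterated_lintegral_eq hGm x, enorm_mul, mul_pow]
          have e1 : ‖(V x : ℂ)‖ₑ = ‖V x‖ₑ := by
            rw [← ofReal_norm, ← ofReal_norm, Complex.norm_real]
          rw [e1]
          gcongr
          have e2 := norm_sq_le_iterated_lintegral β hδ φ x
          rwa [ENNReal.ofReal_pow (norm_nonneg _), ofReal_norm] at e2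
      _ = ∫⁻ y, ∫⁻ x, ‖V x‖ₑ ^ 2 * (unitBox y).indicator (fun _ => G y) x :=
          lintegral_lintegral_swap hjoint
      _ ≤ ∫⁻ y, (N : ℝ≥0∞) ^ 2 * G y := by
          refine lintegral_mono fun y => ?_
          have e1 : ∀ x, ‖V x‖ₑ ^ 2 * (unitBox y).indicator (fun _ => G y) x =
              (unitBox y).indicator (fun x => ‖V x‖ₑ ^ 2 * G y) x := by
            intro x
            by_cases hx : x ∈ unitBox y <;> simp [hx]
          simp only [e1]
          rw [lintegral_indicator (measurableSet_unitBox y), lintegral_mul_const' _ _ (by simp [hG])]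
          gcongr
          exact hN' y
      _ = (N : ℝ≥0∞) ^ 2 * ∫⁻ y, G y := lintegral_const_mul _ hGm
  rw [← enorm_sq_toLp (memLp_potential_mul hV φ.2.1.continuous φ.2.2),
    lintegral_sobolevDensity β hδ φ] at key
  have e3 : (N : ℝ≥0∞) ^ 2 = ENNReal.ofReal ((N : ℝ) ^ 2) := by
    rw [ENNReal.ofReal_pow (by positivity), ENNReal.ofReal_coe_nnreal]
  rw [e3, ← ENNReal.ofReal_mul (by positivity)] at key
  exact (ENNReal.ofReal_le_ofReal_iff (by positivity)).1 key

end BlochLandau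

namespace BlochLandau

open scoped ComplexConjugate
open Filter Topology

/-! ### Relative boundedness of the perturbation -/

lemma memLp_mul_test {b : Plane → ℂ} (hb : Continuous b) (φ : testFunctions) :
    MemLp (fun r => b r * φ.1 r) 2 (volume : Measure Plane) :=
  (hb.mul φ.2.1.continuous).memLp_of_hasCompactSupport φ.2.2.mul_left

lemma norm_toLp_mul_test_le {b : Plane → ℂ} (hb : Continuous b) {M : ℝ} (hM : ∀ r, ‖b r‖ ≤ M)
    (φ : testFunctions) : ‖(memLp_mul_test hb φ).toLp _‖ ≤ M * ‖testToL2 φ‖ := by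
  refine Lp.norm_le_mul_norm_of_ae_le_mul ?_
  filter_upwards [(memLp_mul_test hb φ).coeFn_toLp, (memLp_test φ).coeFn_toLp] with r h1 h2
  rw [testToL2_apply, h1, h2, norm_mul]
  gcongr
  exact hM r

/-- The hypothesis makes the momentum equal to `ħ P_j - a_j`; in its square, the commutator of `P_j`
with `a_j` is `-i ∂_j a_j`. -/
lemma momentum_momentum_eq {ħ κ β : ℝ} {A : Plane → Plane} {a : Fin 2 → Plane → ℝ}
    (hA : ∀ j r, κ * A r j = ħ * uniformPotential β r j + a j r)
    (ha : ∀ j, ContDiff ℝ 1 (a j)) (j : Fin 2) (φ : testFunctions) (r : Plane) :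
    momentum ħ κ A j (momentum ħ κ A j φ.1) r =
      (ħ : ℂ) ^ 2 * (covMomentum β j (covMomentum β j φ)).1 r +
        (-2 * ħ * a j r) * (covMomentum β j φ).1 r +
        (Complex.I * ħ * (fderiv ℝ (a j) r (e j) : ℂ) + (a j r : ℂ) ^ 2) * φ.1 r := by
  have h1 (ψ : Plane → ℂ) (r : Plane) : momentum ħ κ A j ψ r =
      -Complex.I * ħ * fderiv ℝ ψ r (e j) -
        ((ħ : ℂ) * uniformPotential β r j + a j r) * ψ r := by
    have := congrArg (fun x : ℝ => (x : ℂ)) (hA j r)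
    push_cast at this
    rw [momentum, this]
  have h2 : momentum ħ κ A j φ.1 =
      fun r => (ħ : ℂ) * (covMomentum β j φ).1 r - (a j r : ℂ) * φ.1 r := by
    funext r
    rw [h1, covMomentum_apply]
    ring
  have d1 : HasFDerivAt (covMomentum β j φ).1 (fderiv ℝ (covMomentum β j φ).1 r) r :=
    ((covMomentum β j φ).2.1.differentiable (by simp) r).hasFDerivAt
  have d2 : HasFDerivAt φ.1 (fderiv ℝ φ.1 r) r :=
    (φ.2.1.differentiable (by simp) r).hasFDerivAt
  have d3 := (Complex.ofRealCLM.hasFDerivAt (x := a j r)).comp r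
    ((ha j).differentiable (by simp) r).hasFDerivAt
  have d4 : fderiv ℝ (momentum ħ κ A j φ.1) r (e j) =
      (ħ : ℂ) * fderiv ℝ (covMomentum β j φ).1 r (e j) - ((a j r : ℂ) * fderiv ℝ φ.1 r (e j) +
        (fderiv ℝ (a j) r (e j) : ℂ) * φ.1 r) := by
    rw [h2]
    refine (congrArg (fun L => L (e j)) ((d1.const_mul (ħ : ℂ)).sub (d3.mul d2)).fderiv).trans ?_
    simp
    ring
  rw [h1, d4, h2, fderiv_eq_covMomentum β, fderiv_eq_covMomentum β]
  ring_nf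
  simp only [Complex.I_sq]
  ring

lemma exists_norm_hamiltonianOnTest_sub_le {m ħ κ β : ℝ} {A : Plane → Plane} {V : Plane → ℝ}
    (hA : ∀ j, ContDiff ℝ 1 (fun r => A r j)) (hV : IsLocallyL2 V) {a : Fin 2 → Plane → ℝ}
    (hAa : ∀ j r, κ * A r j = ħ * uniformPotential β r j + a j r)
    (ha : ∀ j, ContDiff ℝ 1 (a j)) {M : ℝ} (hM : ∀ j r, |a j r| ≤ M)
    (hM' : ∀ j r, ‖fderiv ℝ (a j) r‖ ≤ M) :
    ∃ C : ℝ, 0 ≤ C ∧ ∀ φ : testFunctions,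
      ‖hamiltonianOnTest m ħ κ A V hA hV φ -
          ((ħ ^ 2 / (2 * m) : ℝ) : ℂ) • testToL2 (covLaplacian β φ)‖ ≤
        C * (‖testToL2 (covMomentum β 0 φ)‖ + ‖testToL2 (covMomentum β 1 φ)‖ + ‖testToL2 φ‖) +
        ‖(memLp_potential_mul hV φ.2.1.continuous φ.2.2).toLp _‖ := by
  have hM0 : 0 ≤ M := (abs_nonneg _).trans (hM 0 0)
  let b : Fin 2 → Plane → ℂ := fun j r => 1 / (2 * m) * (-2 * ħ * a j r)
  let d : Fin 2 → Plane → ℂ := fun j r =>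
    1 / (2 * m) * (Complex.I * ħ * (fderiv ℝ (a j) r (e j) : ℂ) + (a j r : ℂ) ^ 2)
  have ca (j : Fin 2) : Continuous fun r => (a j r : ℂ) :=
    Complex.continuous_ofReal.comp (ha j).continuous
  have cb (j : Fin 2) : Continuous (b j) :=
    continuous_const.mul (continuous_const.mul (ca j))
  have cd (j : Fin 2) : Continuous (d j) :=
    continuous_const.mul ((continuous_const.mul (Complex.continuous_ofReal.comp
      (((ha j).continuous_fderiv (by simp)).clm_apply continuous_const))).add ((ca j).pow 2))
  have bb (j : Fin 2) (r : Plane) : ‖b j r‖ ≤ ‖(1 / (2 * m) : ℂ)‖ * (2 * |ħ| * M) := by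
    simp only [b, norm_mul, norm_neg, Complex.norm_real, Complex.norm_ofNat, Real.norm_eq_abs]
    gcongr
    exact hM j r
  have bd (j : Fin 2) (r : Plane) : ‖d j r‖ ≤ ‖(1 / (2 * m) : ℂ)‖ * (|ħ| * M + M ^ 2) := by
    simp only [d]
    rw [norm_mul]
    gcongr
    refine (norm_add_le _ _).trans ?_
    simp only [norm_mul, norm_pow, Complex.norm_I, Complex.norm_real, Real.norm_eq_abs, one_mul]
    have h1 : |fderiv ℝ (a j) r (e j)| ≤ M := by
      have h2 := (fderiv ℝ (a j) r).le_opNorm (e j)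
      have h3 : ‖e j‖ = 1 := by simp
      rw [h3, mul_one] at h2
      exact h2.trans (hM' j r)
    gcongr
    exact hM j r
  have key (φ : testFunctions) : hamiltonianOnTest m ħ κ A V hA hV φ -
      ((ħ ^ 2 / (2 * m) : ℝ) : ℂ) • testToL2 (covLaplacian β φ) =
      ((memLp_mul_test (cb 0) (covMomentum β 0 φ)).toLp _ +
        (memLp_mul_test (cb 1) (covMomentum β 1 φ)).toLp _) +
      ((memLp_mul_test (cd 0) φ).toLp _ + (memLp_mul_test (cd 1) φ).toLp _) +
      (memLp_potential_mul hV φ.2.1.continuous φ.2.2).toLp _ := by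
    rw [sub_eq_iff_eq_add, testToL2_apply]
    simp only [← MemLp.toLp_add, ← MemLp.toLp_const_smul]
    refine MemLp.toLp_congr (memLp_hamiltonianExpr hA hV φ.2) _ (.of_forall fun r => ?_)
    have hL : (covLaplacian β φ).1 r = (covMomentum β 0 (covMomentum β 0 φ)).1 r +
        (covMomentum β 1 (covMomentum β 1 φ)).1 r := by
      rw [covLaplacian_apply]; rfl
    simp only [Pi.add_apply, Pi.smul_apply, smul_eq_mul, hL, hamiltonianExpr, Fin.sum_univ_two,
      momentum_momentum_eq hAa ha, b, d]
    push_cast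
    ring
  refine ⟨2 * (‖(1 / (2 * m) : ℂ)‖ * (2 * |ħ| * M) + ‖(1 / (2 * m) : ℂ)‖ * (|ħ| * M + M ^ 2)),
    by positivity, fun φ => ?_⟩
  rw [key φ]
  refine (norm_add_le _ _).trans (add_le_add ?_ le_rfl)
  refine (norm_add_le _ _).trans ((add_le_add (norm_add_le _ _) (norm_add_le _ _)).trans ?_)
  have e0 := norm_toLp_mul_test_le (cb 0) (bb 0) (covMomentum β 0 φ)
  have e1 := norm_toLp_mul_test_le (cb 1) (bb 1) (covMomentum β 1 φ)
  have e2 := norm_toLp_mul_test_le (cd 0) (bd 0) φ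
  have e3 := norm_toLp_mul_test_le (cd 1) (bd 1) φ
  refine (add_le_add (add_le_add e0 e1) (add_le_add e2 e3)).trans ?_
  have p0 := norm_nonneg (testToL2 (covMomentum β 0 φ))
  have p1 := norm_nonneg (testToL2 (covMomentum β 1 φ))
  have p2 := norm_nonneg (testToL2 φ)
  have hX : 0 ≤ ‖(1 / (2 * m) : ℂ)‖ * (2 * |ħ| * M) := by positivity
  have hY : 0 ≤ ‖(1 / (2 * m) : ℂ)‖ * (|ħ| * M + M ^ 2) := by positivity
  nlinarith [mul_nonneg hX p0, mul_nonneg hX p1, mul_nonneg hX p2, mul_nonneg hY p0,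
    mul_nonneg hY p1]

/-- `(p₀ + p₁)² ≤ 2 n l`, which is the cross term in the square of the right-hand side. -/
lemma add_le_of_sq_add_sq_le {p₀ p₁ n l η : ℝ} (hη : 0 < η) (hn : 0 ≤ n) (hl : 0 ≤ l)
    (h : p₀ ^ 2 + p₁ ^ 2 ≤ n * l) : p₀ + p₁ ≤ η * l + η⁻¹ * n := by
  refine abs_le_of_sq_le_sq' ?_ (by positivity) |>.2
  have h1 : (η * l) * (η⁻¹ * n) = n * l := by field_simp
  nlinarith [sq_nonneg (p₀ - p₁), sq_nonneg (η * l), sq_nonneg (η⁻¹ * n)]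

/-- The bound on `v²` is compared termwise with `(η l + K n)²`. The choice of `δ` makes `N δ ≤ η²`.
The first summand of `K` covers the cross term, and the second covers `n²` because the final `1`
ensures `K ≤ K²`. -/
lemma potential_bound_aux {N η b δ K n l p₀ p₁ q v : ℝ} (hN : 0 ≤ N) (hη : 0 < η) (hb : 0 ≤ b)
    (hδ : δ = η ^ 2 / (N + 1)) (hK : K = N * (2 + δ * b) / (2 * η) + N * (3 + δ⁻¹) + 1)
    (hn : 0 ≤ n) (hl : 0 ≤ l) (hp : p₀ ^ 2 + p₁ ^ 2 ≤ n * l)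
    (hq : 2 * q ^ 2 ≤ l ^ 2 + 4 * b * (p₀ * p₁))
    (hv : v ^ 2 ≤ N * ((3 + δ⁻¹) * n ^ 2 + 2 * p₀ ^ 2 + 2 * p₁ ^ 2 + δ * q ^ 2)) :
    v ≤ η * l + K * n := by
  have hδ0 : 0 < δ := by rw [hδ]; positivity
  have hK0 : 0 ≤ K := by rw [hK]; positivity
  have hnl : 0 ≤ n * l := mul_nonneg hn hl
  have hpp : 2 * (p₀ * p₁) ≤ n * l := by linarith [sq_nonneg (p₀ - p₁), sub_sq p₀ p₁]
  have hbp := mul_le_mul_of_nonneg_left hpp hb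
  have e1 : N * δ ≤ η ^ 2 := by
    rw [hδ, mul_div_assoc', div_le_iff₀ (by positivity)]
    linarith [sq_nonneg η]
  have e4 : 0 ≤ N * (3 + δ⁻¹) := by positivity
  have e5 : 0 ≤ N * (2 + δ * b) / (2 * η) := by positivity
  have e2 : N * (2 + δ * b) ≤ 2 * η * K := by
    have h1 : N * (2 + δ * b) = 2 * η * (N * (2 + δ * b) / (2 * η)) := by field_simp
    rw [h1]
    gcongr
    linarith
  have e3 : N * (3 + δ⁻¹) ≤ K ^ 2 := by
    have h1 : N * (3 + δ⁻¹) ≤ K := by linarith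
    have h2 : K ≤ K ^ 2 := le_self_pow₀ (by linarith) two_ne_zero
    linarith
  have e8 : δ * q ^ 2 ≤ δ * (l ^ 2 / 2 + b * (n * l)) := by
    gcongr; linarith
  have e9 : v ^ 2 ≤ N * ((3 + δ⁻¹) * n ^ 2 + 2 * (n * l) + δ * (l ^ 2 / 2 + b * (n * l))) := by
    refine hv.trans ?_
    gcongr ?_ * ?_
    linarith
  refine abs_le_of_sq_le_sq' ?_ (by positivity) |>.2
  refine e9.trans ?_
  have f1 := mul_le_mul_of_nonneg_right e1 (sq_nonneg l)
  have f2 := mul_le_mul_of_nonneg_right e2 hnl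
  have f3 := mul_le_mul_of_nonneg_right e3 (sq_nonneg n)
  have f4 : 0 ≤ N * δ * l ^ 2 := by positivity
  calc N * ((3 + δ⁻¹) * n ^ 2 + 2 * (n * l) + δ * (l ^ 2 / 2 + b * (n * l)))
      = N * (3 + δ⁻¹) * n ^ 2 + N * (2 + δ * b) * (n * l) + N * δ * l ^ 2 / 2 := by ring
    _ ≤ K ^ 2 * n ^ 2 + 2 * η * K * (n * l) + η ^ 2 * l ^ 2 := by linarith
    _ = (η * l + K * n) ^ 2 := by ring

/-- The perturbation of the covariant Laplacian has relative bound zero. -/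
lemma exists_relative_bound {m ħ κ β : ℝ} {A : Plane → Plane} {V : Plane → ℝ}
    (hA : ∀ j, ContDiff ℝ 1 (fun r => A r j)) (hV : IsLocallyL2 V) (hVu : IsUniformlyLocallyL2 V)
    {a : Fin 2 → Plane → ℝ} (hAa : ∀ j r, κ * A r j = ħ * uniformPotential β r j + a j r)
    (ha : ∀ j, ContDiff ℝ 1 (a j)) {M : ℝ} (hM : ∀ j r, |a j r| ≤ M)
    (hM' : ∀ j r, ‖fderiv ℝ (a j) r‖ ≤ M) {ε : ℝ} (hε : 0 < ε) :
    ∃ K : ℝ, 0 ≤ K ∧ ∀ φ : testFunctions,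
      ‖hamiltonianOnTest m ħ κ A V hA hV φ -
          ((ħ ^ 2 / (2 * m) : ℝ) : ℂ) • testToL2 (covLaplacian β φ)‖ ≤
        ε * ‖testToL2 (covLaplacian β φ)‖ + K * ‖testToL2 φ‖ := by
  obtain ⟨C, hC, hC'⟩ := exists_norm_hamiltonianOnTest_sub_le (m := m) hA hV hAa ha hM hM'
  obtain ⟨N, hN, hN'⟩ := exists_norm_potential_mul_le hV hVu
  -- The first-order part uses `C η` of the allowance and the potential uses `η`, in total `ε`.
  set η := ε / (C + 1) with hη
  have hη0 : 0 < η := by positivity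
  set δ := η ^ 2 / (N + 1) with hδ
  have hδ0 : 0 < δ := by positivity
  set K' := N * (2 + δ * |β|) / (2 * η) + N * (3 + δ⁻¹) + 1 with hK'
  have hK'0 : 0 ≤ K' := by positivity
  refine ⟨C * (η⁻¹ + 1) + K', by positivity, fun φ => ?_⟩
  refine (hC' φ).trans ?_
  have h1 := sum_norm_sq_covMomentum_le β φ
  have h2 := norm_sq_covLaplacian β φ
  have h3 := hN' β δ hδ0 φ
  set v := ‖(memLp_potential_mul hV φ.2.1.continuous φ.2.2).toLp _‖
  set n := ‖testToL2 φ‖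
  set l := ‖testToL2 (covLaplacian β φ)‖
  set p₀ := ‖testToL2 (covMomentum β 0 φ)‖
  set p₁ := ‖testToL2 (covMomentum β 1 φ)‖
  set q := ‖testToL2 (covMomentum β 1 (covMomentum β 0 φ))‖
  have hn : 0 ≤ n := norm_nonneg _
  have hl : 0 ≤ l := norm_nonneg _
  have h4 : p₀ + p₁ ≤ η * l + η⁻¹ * n := add_le_of_sq_add_sq_le hη0 hn hl h1
  have h7 : v ≤ η * l + K' * n := by
    refine potential_bound_aux hN hη0 (abs_nonneg β) hδ hK' hn hl h1 ?_ h3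
    linarith [sq_nonneg ‖testToL2 (covMomentum β 0 (covMomentum β 0 φ))‖,
      sq_nonneg ‖testToL2 (covMomentum β 1 (covMomentum β 1 φ))‖]
  have h8 : C * η + η = ε := by rw [hη]; field_simp
  have h9 := mul_le_mul_of_nonneg_left h4 hC
  have h10 : ε * l = (C * η + η) * l := by rw [h8]
  rw [h10]
  linarith

end BlochLandau

namespace BlochLandau

open scoped ComplexConjugate
open Filter Topology

/-! ### Covariant derivatives of tempered distributions -/

lemma hasTemperateGrowth_potential (β : ℝ) (j : Fin 2) :
    Function.HasTemperateGrowth fun x : Plane => Complex.I * (uniformPotential β x j : ℂ) := by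
  have h (c : ℝ) (k : Fin 2) :
      Function.HasTemperateGrowth fun x : Plane => Complex.I * ((c * x k : ℝ) : ℂ) := by
    exact ((ContinuousLinearMap.mul ℝ ℂ Complex.I) ∘L Complex.ofRealCLM ∘L
      (c • (EuclideanSpace.proj k : Plane →L[ℝ] ℝ))).hasTemperateGrowth
  fin_cases j
  · exact h (-(β / 2)) 1
  · exact h (β / 2) 0

lemma toTemperedDistribution_eq_integral (f : L2) (χ : 𝓢(Plane, ℂ)) :
    (f : 𝓢'(Plane, ℂ)) χ = ∫ x, χ x * f x := by
  rw [Lp.toTemperedDistribution_apply]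
  rfl

lemma magneticD_apply (β : ℝ) (j : Fin 2) (f : L2) (χ : 𝓢(Plane, ℂ)) :
    magneticD β j (f : 𝓢'(Plane, ℂ)) χ =
      ∫ x, (-fderiv ℝ χ x (e j) - Complex.I * uniformPotential β x j * χ x) * f x := by
  have h : magneticD β j (f : 𝓢'(Plane, ℂ)) χ = (f : 𝓢'(Plane, ℂ))
      (-∂_{e j} χ - SchwartzMap.smulLeftCLM ℂ
        (fun x => Complex.I * (uniformPotential β x j : ℂ)) χ) := by
    rw [map_sub]
    rfl
  rw [h, toTemperedDistribution_eq_integral]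
  congr 1
  funext x
  congr 1
  rw [_root_.sub_apply, _root_.neg_apply,
    SchwartzMap.smulLeftCLM_apply_apply (hasTemperateGrowth_potential β j),
    SchwartzMap.lineDerivOp_apply_eq_fderiv, smul_eq_mul]

lemma conj_covMomentum_apply (β : ℝ) (j : Fin 2) (φ : testFunctions) (x : Plane) :
    Complex.I * conj ((covMomentum β j φ).1 x) =
      -fderiv ℝ (fun y => conj (φ.1 y)) x (e j) -
        Complex.I * uniformPotential β x j * conj (φ.1 x) := by
  rw [fderiv_conj (φ.2.1.differentiable (by simp) x), covMomentum_apply]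
  simp only [map_sub, map_mul, map_neg, Complex.conj_I, Complex.conj_ofReal]
  linear_combination conj (fderiv ℝ φ.1 x (e j)) * Complex.I_sq

/-- On test functions the distributional covariant derivative is the classical one. -/
lemma magneticD_testToL2 (β : ℝ) (j : Fin 2) (φ : testFunctions) :
    magneticD β j (testToL2 φ : 𝓢'(Plane, ℂ)) =
      ((Complex.I • testToL2 (covMomentum β j φ) : L2) : 𝓢'(Plane, ℂ)) := by
  ext χ
  rw [magneticD_apply, ← map_smul, toTemperedDistribution_eq_integral]
  have hχ : ContDiff ℝ 1 fun x => conj (χ x) := contDiff_conj (χ.smooth 1)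
  have key := integral_conj_momentum_mul (ħ := 1) (κ := 1) (j := j)
    (contDiff_uniformPotential (n := 1) β j).continuous (φ.2.1.of_le (by simp)) hχ φ.2.2
  have key' := congrArg (fun z => Complex.I * conj z) key
  simp only [← integral_conj, ← integral_const_mul] at key'
  have e1 : ∫ x, χ x * (testToL2 (Complex.I • covMomentum β j φ) : L2) x =
      ∫ x, Complex.I * conj (conj ((covMomentum β j φ).1 x) * conj (χ x)) := by
    refine integral_congr_ae ?_
    filter_upwards [(memLp_test (Complex.I • covMomentum β j φ)).coeFn_toLp] with x hx
    rw [testToL2_apply, hx]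
    change χ x * (Complex.I * (covMomentum β j φ).1 x) = _
    rw [map_mul, Complex.conj_conj, Complex.conj_conj]
    ring
  rw [e1]
  refine Eq.trans ?_ key'.symm
  refine integral_congr_ae ?_
  filter_upwards [(memLp_test φ).coeFn_toLp] with x hx
  rw [testToL2_apply, hx, momentum, fderiv_conj (χ.differentiable x)]
  simp only [map_sub, map_mul, map_neg, Complex.conj_I, Complex.conj_ofReal, Complex.conj_conj,
    Complex.ofReal_one]
  ring_nf
  simp

lemma inner_testToL2_left (φ : testFunctions) (f : L2) :
    inner ℂ (testToL2 φ) f = ∫ y, conj (φ.1 y) * f y := by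
  rw [L2.inner_def]
  refine integral_congr_ae ?_
  filter_upwards [(memLp_test φ).coeFn_toLp] with y h
  rw [testToL2_apply, h, RCLike.inner_apply, mul_comm]

/-- Weak formulation of the distributional covariant derivative. -/
lemma inner_covMomentum_of_magneticD_eq {β : ℝ} {j : Fin 2} {f g : L2}
    (h : magneticD β j (f : 𝓢'(Plane, ℂ)) = (g : 𝓢'(Plane, ℂ))) (φ : testFunctions) :
    Complex.I * inner ℂ (testToL2 (covMomentum β j φ)) f = inner ℂ (testToL2 φ) g := by
  -- The distributional pairing is bilinear and the inner product sesquilinear, so the Schwartz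
  -- function is the conjugate of `φ`.
  let χ : 𝓢(Plane, ℂ) := (hasCompactSupport_conj φ.2.2).toSchwartzMap (contDiff_conj φ.2.1)
  have h1 := congrArg (fun T : 𝓢'(Plane, ℂ) => T χ) h
  rw [magneticD_apply, toTemperedDistribution_eq_integral] at h1
  rw [inner_testToL2_left, inner_testToL2_left, ← integral_const_mul]
  refine Eq.trans ?_ h1
  refine integral_congr_ae (.of_forall fun x => ?_)
  simp only
  rw [← mul_assoc, conj_covMomentum_apply]
  rfl

/-- Convergence in `L²` implies convergence as distributions, where `D_j = i P_j` is continuous. -/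
lemma magneticD_eq_of_tendsto {β : ℝ} {j : Fin 2} {φ : ℕ → testFunctions} {f g : L2}
    (hf : Tendsto (fun n => testToL2 (φ n)) atTop (𝓝 f))
    (hg : Tendsto (fun n => testToL2 (covMomentum β j (φ n))) atTop (𝓝 g)) :
    magneticD β j (f : 𝓢'(Plane, ℂ)) = ((Complex.I • g : L2) : 𝓢'(Plane, ℂ)) := by
  let E := Lp.toTemperedDistributionCLM ℂ (volume : Measure Plane) 2
  have h1 : Tendsto (fun n => magneticD β j (E (testToL2 (φ n)))) atTop
      (𝓝 (magneticD β j (E f))) :=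
    (((magneticD β j).continuous.comp E.continuous).tendsto f).comp hf
  have h2 : Tendsto (fun n => E (Complex.I • testToL2 (covMomentum β j (φ n)))) atTop
      (𝓝 (E (Complex.I • g))) :=
    (E.continuous.tendsto _).comp (hg.const_smul _)
  exact tendsto_nhds_unique (h1.congr fun n => magneticD_testToL2 β j (φ n)) h2

lemma magneticD_zero : magneticD 0 = partialD := by
  funext j
  have : (fun x : Plane => Complex.I * (uniformPotential 0 x j : ℂ)) = fun _ => 0 := by
    funext x
    fin_cases j <;> simp [uniformPotential]
  ext f χ
  simp [magneticD, this]

end BlochLandau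

namespace BlochLandau

open scoped ComplexConjugate
open Filter Topology

/-! ### Essential self-adjointness and the domain of the closure -/

lemma essentiallySelfAdjoint_aux {m ħ κ β : ℝ} (hm : 0 < m) (hħ : 0 < ħ) {A : Plane → Plane}
    {V : Plane → ℝ}
    (hA : ∀ j, ContDiff ℝ 1 (fun r => A r j)) (hV : IsLocallyL2 V)
    (hrel : ∀ ε : ℝ, 0 < ε → ∃ K : ℝ, 0 ≤ K ∧ ∀ φ : testFunctions,
      ‖hamiltonianOnTest m ħ κ A V hA hV φ -
          ((ħ ^ 2 / (2 * m) : ℝ) : ℂ) • testToL2 (covLaplacian β φ)‖ ≤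
        ε * ‖testToL2 (covLaplacian β φ)‖ + K * ‖testToL2 φ‖) :
    (schrodinger m ħ κ A V hA hV).IsClosable ∧ IsSelfAdjoint (schrodinger m ħ κ A V hA hV).closure ∧
      (schrodinger m ħ κ A V hA hV).closure = (schrodinger m ħ κ A V hA hV).adjoint := by
  set c := ħ ^ 2 / (2 * m) with hc
  have hc0 : 0 < c := by positivity
  -- With `l ≥ 4K` each of the two terms of the relative bound is at most a quarter of `‖(K₀ + l)
  -- φ‖`, so the Kato–Rellich constant is `1/2`.
  obtain ⟨K, hK, hKφ⟩ := hrel (c / 4) (by positivity)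
  set l := 4 * (K + 1) with hl
  have hl0 : 0 < l := by positivity
  let K₀ : testFunctions →ₗ[ℂ] L2 := (c : ℂ) • (testToL2 ∘ₗ covLaplacian β)
  have hK₀ (φ : testFunctions) : K₀ φ = (c : ℂ) • testToL2 (covLaplacian β φ) := rfl
  -- The cross term is a positive multiple of `⟨Lφ, φ⟩ ≥ 0` and can be dropped.
  have hsq (φ : testFunctions) : (c * ‖testToL2 (covLaplacian β φ)‖) ^ 2 + (l * ‖testToL2 φ‖) ^ 2 ≤
      ‖K₀ φ + (l : ℂ) • testToL2 φ‖ ^ 2 := by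
    rw [@norm_add_sq ℂ, hK₀, norm_smul, norm_smul, Complex.norm_real, Complex.norm_real,
      Real.norm_of_nonneg hc0.le, Real.norm_of_nonneg hl0.le, inner_smul_left, inner_smul_right,
      inner_covLaplacian_self, Complex.conj_ofReal, ← Complex.ofReal_mul, ← Complex.ofReal_mul]
    change _ ≤ _ + 2 * (c * (l * (‖testToL2 (covMomentum β 0 φ)‖ ^ 2 +
      ‖testToL2 (covMomentum β 1 φ)‖ ^ 2))) + _
    have : 0 ≤ c * (l * (‖testToL2 (covMomentum β 0 φ)‖ ^ 2 +
      ‖testToL2 (covMomentum β 1 φ)‖ ^ 2)) := by positivity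
    linarith
  have hle₁ (φ : testFunctions) : c * ‖testToL2 (covLaplacian β φ)‖ ≤
      ‖K₀ φ + (l : ℂ) • testToL2 φ‖ :=
    (abs_le_of_sq_le_sq' ((le_add_of_nonneg_right (sq_nonneg _)).trans (hsq φ)) (norm_nonneg _)).2
  have hle₂ (φ : testFunctions) : l * ‖testToL2 φ‖ ≤ ‖K₀ φ + (l : ℂ) • testToL2 φ‖ :=
    (abs_le_of_sq_le_sq' ((le_add_of_nonneg_left (sq_nonneg _)).trans (hsq φ)) (norm_nonneg _)).2
  have hbound (φ : testFunctions) : ‖hamiltonianOnTest m ħ κ A V hA hV φ - K₀ φ‖ ≤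
      1 / 2 * ‖K₀ φ + (l : ℂ) • testToL2 φ‖ := by
    have h1 := hKφ φ
    rw [← hK₀] at h1
    have h2 := hle₁ φ
    have h3 := hle₂ φ
    have h4 : K * ‖testToL2 φ‖ ≤ l * ‖testToL2 φ‖ / 4 := by
      rw [hl]
      linarith [norm_nonneg (testToL2 φ)]
    linarith
  have hdense₀ : ∀ u, (∀ φ, inner ℂ u (K₀ φ + (l : ℂ) • testToL2 φ) = 0) → u = 0 := by
    intro u hu
    refine eq_zero_of_inner_covLaplacian_add_eq_zero (β := β) (div_pos hl0 hc0) fun φ => ?_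
    have h1 := hu φ
    have h2 : K₀ φ + (l : ℂ) • testToL2 φ = (c : ℂ) •
        (testToL2 (covLaplacian β φ) + ((l / c : ℝ) : ℂ) • testToL2 φ) := by
      have hc' : (c : ℂ) ≠ 0 := by exact_mod_cast hc0.ne'
      rw [hK₀, smul_add, smul_smul]
      congr 2
      push_cast
      field_simp
    rw [h2, inner_smul_right] at h1
    exact (mul_eq_zero.1 h1).resolve_left (by exact_mod_cast hc0.ne')
  refine (hasGraph_schrodinger hA hV).essentiallySelfAdjoint denseRange_testToL2
    (hamiltonianOnTest_symmetric hA hV) (l := l) (c := l / 2) (by positivity) (fun φ => ?_)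
    (dense_range_of_relatively_bounded (K₀ := K₀) (by norm_num : (1 / 2 : ℝ) < 1) hdense₀ hbound)
  -- The perturbation consumes at most half of `‖(K₀ + l) φ‖ ≥ l ‖φ‖`, which leaves the lower bound
  -- `l / 2`.
  have h1 := hbound φ
  have h2 := hle₂ φ
  have h3 : ‖K₀ φ + (l : ℂ) • testToL2 φ‖ ≤
      ‖hamiltonianOnTest m ħ κ A V hA hV φ + (l : ℂ) • testToL2 φ‖ +
        ‖hamiltonianOnTest m ħ κ A V hA hV φ - K₀ φ‖ := by
    refine le_trans (le_of_eq ?_) (norm_sub_le _ _)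
    congr 1
    abel
  linarith

lemma cauchySeq_of_norm_le {D E F G : Type*} [AddCommGroup D] [Module ℂ D]
    [NormedAddCommGroup E] [NormedSpace ℂ E] [NormedAddCommGroup F] [NormedSpace ℂ F]
    [NormedAddCommGroup G] [NormedSpace ℂ G] {S : D →ₗ[ℂ] E} {J : D →ₗ[ℂ] F} {K : D →ₗ[ℂ] G}
    {c₁ c₂ : ℝ} (hc₁ : 0 ≤ c₁) (hc₂ : 0 ≤ c₂) (h : ∀ φ, ‖S φ‖ ≤ c₁ * ‖K φ‖ + c₂ * ‖J φ‖)
    {φ : ℕ → D} (hJ : CauchySeq fun n => J (φ n)) (hK : CauchySeq fun n => K (φ n)) :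
    CauchySeq fun n => S (φ n) := by
  rw [Metric.cauchySeq_iff] at *
  intro ε hε
  obtain ⟨N₁, h₁⟩ := hJ (ε / (c₁ + c₂ + 1)) (by positivity)
  obtain ⟨N₂, h₂⟩ := hK (ε / (c₁ + c₂ + 1)) (by positivity)
  refine ⟨max N₁ N₂, fun k hk n hn => ?_⟩
  have e₁ := h₁ k (le_of_max_le_left hk) n (le_of_max_le_left hn)
  have e₂ := h₂ k (le_of_max_le_right hk) n (le_of_max_le_right hn)
  rw [dist_eq_norm, ← map_sub] at e₁ e₂ ⊢
  refine (h _).trans_lt ?_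
  have e₃ := mul_le_mul_of_nonneg_left e₁.le hc₂
  have e₄ := mul_le_mul_of_nonneg_left e₂.le hc₁
  have e₅ : c₁ * (ε / (c₁ + c₂ + 1)) + c₂ * (ε / (c₁ + c₂ + 1)) < ε := by
    rw [← add_mul, mul_div_assoc', div_lt_iff₀ (by positivity)]
    linarith
  linarith

/-- Each covariant derivative up to order two is bounded by the graph norm of the covariant
Laplacian: `4|β| ‖P₀χ‖ ‖P₁χ‖ ≤ 2|β| ‖χ‖ ‖Lχ‖`, so `‖Lχ‖ + |β| ‖χ‖` dominates the second derivatives.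
-/
lemma cauchySeq_covariant {β : ℝ} {φ : ℕ → testFunctions} (hJ : CauchySeq fun n => testToL2 (φ n))
    (hL : CauchySeq fun n => testToL2 (covLaplacian β (φ n))) :
    (∀ j, CauchySeq fun n => testToL2 (covMomentum β j (φ n))) ∧
    (∀ j, CauchySeq fun n => testToL2 (covMomentum β j (covMomentum β j (φ n)))) ∧
    (CauchySeq fun n => testToL2 (covMomentum β 0 (covMomentum β 1 (φ n)))) := by
  have hn (χ : testFunctions) := norm_nonneg (testToL2 χ)
  have hpp (χ : testFunctions) : 2 * (‖testToL2 (covMomentum β 0 χ)‖ *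
      ‖testToL2 (covMomentum β 1 χ)‖) ≤ ‖testToL2 χ‖ * ‖testToL2 (covLaplacian β χ)‖ := by
    have := sum_norm_sq_covMomentum_le β χ
    linarith [sq_nonneg (‖testToL2 (covMomentum β 0 χ)‖ - ‖testToL2 (covMomentum β 1 χ)‖),
      sub_sq ‖testToL2 (covMomentum β 0 χ)‖ ‖testToL2 (covMomentum β 1 χ)‖]
  have h1 (j : Fin 2) (χ : testFunctions) : ‖testToL2 (covMomentum β j χ)‖ ≤
      1 * ‖testToL2 (covLaplacian β χ)‖ + 1 * ‖testToL2 χ‖ := by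
    have h := add_le_of_sq_add_sq_le one_pos (hn χ) (hn _) (sum_norm_sq_covMomentum_le β χ)
    rw [inv_one] at h
    have h0 := hn (covMomentum β 0 χ)
    have h1 := hn (covMomentum β 1 χ)
    fin_cases j
    · exact (le_add_of_nonneg_right h1).trans h
    · exact (le_add_of_nonneg_left h0).trans h
  have h2 (χ : testFunctions) : ‖testToL2 (covLaplacian β χ)‖ ^ 2 +
      4 * |β| * (‖testToL2 (covMomentum β 0 χ)‖ * ‖testToL2 (covMomentum β 1 χ)‖) ≤
      (1 * ‖testToL2 (covLaplacian β χ)‖ + |β| * ‖testToL2 χ‖) ^ 2 := by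
    have h := mul_le_mul_of_nonneg_left (hpp χ) (abs_nonneg β)
    have h' : 0 ≤ (|β| * ‖testToL2 χ‖) ^ 2 := sq_nonneg _
    linarith [add_sq (1 * ‖testToL2 (covLaplacian β χ)‖) (|β| * ‖testToL2 χ‖)]
  have h3 (χ : testFunctions) {y : ℝ} (hy : y ^ 2 ≤ ‖testToL2 (covLaplacian β χ)‖ ^ 2 +
      4 * |β| * (‖testToL2 (covMomentum β 0 χ)‖ * ‖testToL2 (covMomentum β 1 χ)‖)) :
      y ≤ 1 * ‖testToL2 (covLaplacian β χ)‖ + |β| * ‖testToL2 χ‖ :=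
    (abs_le_of_sq_le_sq' (hy.trans (h2 χ)) (by positivity)).2
  have hP (j : Fin 2) : CauchySeq fun n => testToL2 (covMomentum β j (φ n)) :=
    cauchySeq_of_norm_le (S := testToL2 ∘ₗ covMomentum β j) (J := testToL2)
      (K := testToL2 ∘ₗ covLaplacian β) zero_le_one zero_le_one (h1 j) hJ hL
  refine ⟨hP, fun j => ?_, ?_⟩
  · refine cauchySeq_of_norm_le (S := testToL2 ∘ₗ covMomentum β j ∘ₗ covMomentum β j)
      (J := testToL2) (K := testToL2 ∘ₗ covLaplacian β) zero_le_one (abs_nonneg β)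
      (fun χ => h3 χ ?_) hJ hL
    have h := norm_sq_covLaplacian β χ
    have e0 := sq_nonneg ‖testToL2 (covMomentum β 0 (covMomentum β 0 χ))‖
    have e1 := sq_nonneg ‖testToL2 (covMomentum β 1 (covMomentum β 1 χ))‖
    have e2 := sq_nonneg ‖testToL2 (covMomentum β 1 (covMomentum β 0 χ))‖
    fin_cases j
    · change ‖testToL2 (covMomentum β 0 (covMomentum β 0 χ))‖ ^ 2 ≤ _
      linarith
    · change ‖testToL2 (covMomentum β 1 (covMomentum β 1 χ))‖ ^ 2 ≤ _
      linarith
  · have h4 : CauchySeq fun n => testToL2 (covMomentum β 1 (covMomentum β 0 (φ n))) := by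
      refine cauchySeq_of_norm_le (S := testToL2 ∘ₗ covMomentum β 1 ∘ₗ covMomentum β 0)
        (J := testToL2) (K := testToL2 ∘ₗ covLaplacian β) zero_le_one (abs_nonneg β)
        (fun χ => h3 χ ?_) hJ hL
      have h := norm_sq_covLaplacian β χ
      have e0 := sq_nonneg ‖testToL2 (covMomentum β 0 (covMomentum β 0 χ))‖
      have e1 := sq_nonneg ‖testToL2 (covMomentum β 1 (covMomentum β 1 χ))‖
      have e2 := sq_nonneg ‖testToL2 (covMomentum β 1 (covMomentum β 0 χ))‖
      change ‖testToL2 (covMomentum β 1 (covMomentum β 0 χ))‖ ^ 2 ≤ _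
      linarith
    -- The energy identity controls `P₁P₀`, while the Sobolev space is defined with `P₀P₁`; the two
    -- differ by `iβ`.
    have h5 : CauchySeq fun n => (Complex.I * (β : ℂ)) • testToL2 (φ n) :=
      (uniformContinuous_const_smul (Complex.I * (β : ℂ))).comp_cauchySeq hJ
    have h6 : (fun n => testToL2 (covMomentum β 0 (covMomentum β 1 (φ n)))) =
        (fun n => testToL2 (covMomentum β 1 (covMomentum β 0 (φ n)))) +
          fun n => (Complex.I * (β : ℂ)) • testToL2 (φ n) := by
      funext n
      rw [Pi.add_apply, ← map_smul, ← map_add, ← covMomentum_comm]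
      congr 1
      abel
    rw [h6]
    exact h4.add h5

lemma mem_magneticSobolevTwo_of_tendsto {β : ℝ} {ψ : L2} {φ : ℕ → testFunctions}
    (hJ : Tendsto (fun n => testToL2 (φ n)) atTop (𝓝 ψ))
    (hL : CauchySeq fun n => testToL2 (covLaplacian β (φ n))) : ψ ∈ magneticSobolevTwo β := by
  obtain ⟨h1, h2, h3⟩ := cauchySeq_covariant hJ.cauchySeq hL
  choose g₁ hg₁ using fun j => cauchySeq_tendsto_of_complete (h1 j)
  choose g₂ hg₂ using fun j => cauchySeq_tendsto_of_complete (h2 j)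
  obtain ⟨g₃, hg₃⟩ := cauchySeq_tendsto_of_complete h3
  have hsmul (j : Fin 2) (g : L2) : magneticD β j ((Complex.I • g : L2) : 𝓢'(Plane, ℂ)) =
      Complex.I • magneticD β j (g : 𝓢'(Plane, ℂ)) := by
    rw [← map_smul]
    congr 1
    exact map_smul (Lp.toTemperedDistributionCLM ℂ (volume : Measure Plane) 2) _ _
  have hsmul' (g : L2) : ((Complex.I • g : L2) : 𝓢'(Plane, ℂ)) =
      Complex.I • (g : 𝓢'(Plane, ℂ)) :=
    map_smul (Lp.toTemperedDistributionCLM ℂ (volume : Measure Plane) 2) _ _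
  have e1 (j : Fin 2) := magneticD_eq_of_tendsto hJ (hg₁ j)
  have e2 (j : Fin 2) := magneticD_eq_of_tendsto (hg₁ j) (hg₂ j)
  have e3 := magneticD_eq_of_tendsto (hg₁ 1) hg₃
  intro n₁ n₂ hn
  have hn₁ : n₁ ≤ 2 := by omega
  have hn₂ : n₂ ≤ 2 := by omega
  interval_cases n₁ <;> interval_cases n₂ <;> first | omega | skip
  · exact ⟨ψ, rfl⟩
  · exact ⟨_, by rw [pow_zero, one_mul, pow_one]; exact e1 1⟩
  · refine ⟨Complex.I • Complex.I • g₂ 1, ?_⟩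
    rw [pow_zero, one_mul, pow_two, mul_apply_eq_comp, e1, hsmul, e2,
      hsmul' (Complex.I • g₂ 1)]
  · exact ⟨_, by rw [pow_zero, mul_one, pow_one]; exact e1 0⟩
  · refine ⟨Complex.I • Complex.I • g₃, ?_⟩
    rw [pow_one, pow_one, mul_apply_eq_comp, e1, hsmul, e3, hsmul' (Complex.I • g₃)]
  · refine ⟨Complex.I • Complex.I • g₂ 0, ?_⟩
    rw [pow_zero, mul_one, pow_two, mul_apply_eq_comp, e1, hsmul, e2,
      hsmul' (Complex.I • g₂ 0)]

lemma inner_covLaplacian_of_mem {β : ℝ} {ψ : L2} (hψ : ψ ∈ magneticSobolevTwo β) :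
    ∃ w : L2, ∀ φ, inner ℂ w (testToL2 φ) = inner ℂ ψ (testToL2 (covLaplacian β φ)) := by
  obtain ⟨f₀, hf₀⟩ := hψ 1 0 (by norm_num)
  obtain ⟨f₁, hf₁⟩ := hψ 0 1 (by norm_num)
  obtain ⟨g₀, hg₀⟩ := hψ 2 0 (by norm_num)
  obtain ⟨g₁, hg₁⟩ := hψ 0 2 (by norm_num)
  rw [pow_one, pow_zero, mul_one] at hf₀
  rw [pow_one, pow_zero, one_mul] at hf₁
  rw [pow_two, pow_zero, mul_one, mul_apply_eq_comp, hf₀] at hg₀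
  rw [pow_two, pow_zero, one_mul, mul_apply_eq_comp, hf₁] at hg₁
  -- The minus sign comes from `P_j² = -D_j²`.
  refine ⟨-(g₀ + g₁), fun φ => ?_⟩
  have h0 := inner_covMomentum_of_magneticD_eq hf₀ (covMomentum β 0 φ)
  have h1 := inner_covMomentum_of_magneticD_eq hf₁ (covMomentum β 1 φ)
  have h2 := inner_covMomentum_of_magneticD_eq hg₀ φ
  have h3 := inner_covMomentum_of_magneticD_eq hg₁ φ
  rw [← inner_conj_symm, ← inner_conj_symm ψ]
  congr 1
  rw [inner_neg_right, inner_add_right, ← h2, ← h3, ← h0, ← h1, covLaplacian_apply, map_add,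
    inner_add_left, ← mul_assoc, ← mul_assoc, Complex.I_mul_I]
  ring

/-- The values `m = 1/2`, `ħ = κ = 1` make the prefactor one, so the self-adjointness criterion also
applies to the covariant Laplacian itself. -/
lemma hamiltonianOnTest_free (β : ℝ) (φ : testFunctions) :
    hamiltonianOnTest (1 / 2) 1 1 (uniformPotential β) (fun _ => 0)
      (contDiff_uniformPotential β) (isLocallyL2_of_continuous continuous_const) φ =
    testToL2 (covLaplacian β φ) := by
  rw [testToL2_apply]
  refine MemLp.toLp_congr (memLp_hamiltonianExpr (contDiff_uniformPotential β)
    (isLocallyL2_of_continuous continuous_const) φ.2) _ (.of_forall fun r => ?_)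
  rw [covLaplacian_apply]
  change _ = (covMomentum β 0 (covMomentum β 0 φ)).1 r + (covMomentum β 1 (covMomentum β 1 φ)).1 r
  simp [hamiltonianExpr, Fin.sum_univ_two, covMomentum]

/-- The magnetic Sobolev space is the domain of the closure of the covariant Laplacian. -/
lemma mem_magneticSobolevTwo_iff {β : ℝ} {ψ : L2} : ψ ∈ magneticSobolevTwo β ↔
    ∃ φ : ℕ → testFunctions, Tendsto (fun n => testToL2 (φ n)) atTop (𝓝 ψ) ∧
      CauchySeq fun n => testToL2 (covLaplacian β (φ n)) := by
  refine ⟨fun hψ => ?_, fun ⟨φ, h1, h2⟩ => mem_magneticSobolevTwo_of_tendsto h1 h2⟩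
  have hA := contDiff_uniformPotential (n := 1) β
  have hV : IsLocallyL2 fun _ => 0 := isLocallyL2_of_continuous continuous_const
  have hG := hasGraph_schrodinger (m := 1 / 2) (ħ := 1) (κ := 1) hA hV
  obtain ⟨hcl, -, hadj⟩ := essentiallySelfAdjoint_aux (m := 1 / 2) (ħ := 1) (κ := 1) (β := β)
    (by norm_num) one_pos hA hV fun ε hε => ⟨0, le_rfl, fun φ => by
      rw [hamiltonianOnTest_free]
      norm_num
      positivity⟩
  obtain ⟨w, hw⟩ := inner_covLaplacian_of_mem hψ
  -- A Sobolev function is in the domain of the adjoint by weak differentiation. Since the adjoint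
  -- is the closure, it is a graph-norm limit of test functions, without any explicit cut-off or
  -- mollification.
  have hmem : (ψ, w) ∈ (schrodinger (1 / 2) 1 1 (uniformPotential β) (fun _ => 0) hA hV).adjoint.graph :=
    (hG.mem_graph_adjoint_iff denseRange_testToL2).2 fun φ => by
      rw [hamiltonianOnTest_free]
      exact hw φ
  rw [← hadj] at hmem
  obtain ⟨φ, h1, h2⟩ := (hG.mem_closure_graph_iff hcl).1 hmem
  simp only [hamiltonianOnTest_free] at h2
  exact ⟨φ, h1, h2.cauchySeq⟩

/-- Essential self-adjointness and the domain of the closure for a Schrödinger operator whose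
vector potential differs from that of a uniform field by a bounded perturbation of class `C¹` with
bounded derivatives, and whose scalar potential is uniformly locally square integrable. -/
theorem schrodinger_essentiallySelfAdjoint {m ħ κ β : ℝ} (hm : 0 < m) (hħ : 0 < ħ)
    {A : Plane → Plane} {V : Plane → ℝ}
    (hA : ∀ j, ContDiff ℝ 1 (fun r => A r j)) (hV : IsLocallyL2 V) (hVu : IsUniformlyLocallyL2 V)
    {a : Fin 2 → Plane → ℝ} (hAa : ∀ j r, κ * A r j = ħ * uniformPotential β r j + a j r)
    (ha : ∀ j, ContDiff ℝ 1 (a j)) {M : ℝ} (hM : ∀ j r, |a j r| ≤ M)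
    (hM' : ∀ j r, ‖fderiv ℝ (a j) r‖ ≤ M) :
    IsEssentiallySelfAdjoint (schrodinger m ħ κ A V hA hV) ∧
      (schrodinger m ħ κ A V hA hV).closure.domain = magneticSobolevTwo β := by
  have hrel (ε : ℝ) (hε : 0 < ε) := exists_relative_bound (m := m) hA hV hVu hAa ha hM hM' hε
  obtain ⟨hcl, hsa, -⟩ := essentiallySelfAdjoint_aux hm hħ hA hV hrel
  refine ⟨⟨hcl, hsa⟩, ?_⟩
  have hc0 : 0 < ħ ^ 2 / (2 * m) := by positivity
  set c := ħ ^ 2 / (2 * m) with hc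
  obtain ⟨K, hK, hKφ⟩ := hrel (c / 2) (by positivity)
  have hnorm (φ : testFunctions) : ‖(c : ℂ) • testToL2 (covLaplacian β φ)‖ =
      c * ‖testToL2 (covLaplacian β φ)‖ := by
    rw [norm_smul, Complex.norm_real, Real.norm_of_nonneg hc0.le]
  ext ψ
  rw [(hasGraph_schrodinger hA hV).mem_closure_domain_iff hcl, mem_magneticSobolevTwo_iff]
  -- The relative bound `c / 2 < c` makes the two graph norms equivalent, so the same sequences of
  -- test functions serve for both operators.
  refine exists_congr fun φ => and_congr_right fun hφ => ⟨fun h => ?_, fun h => ?_⟩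
  · refine cauchySeq_of_norm_le (S := testToL2 ∘ₗ covLaplacian β) (J := testToL2)
      (c₁ := 2 / c) (c₂ := 2 / c * K) (by positivity) (by positivity) (fun χ => ?_)
      hφ.cauchySeq h
    have h1 := norm_sub_norm_le ((c : ℂ) • testToL2 (covLaplacian β χ))
      (hamiltonianOnTest m ħ κ A V hA hV χ)
    rw [hnorm, norm_sub_rev] at h1
    have h2 := hKφ χ
    change ‖testToL2 (covLaplacian β χ)‖ ≤ _
    have h3 : c / 2 * ‖testToL2 (covLaplacian β χ)‖ ≤
        ‖hamiltonianOnTest m ħ κ A V hA hV χ‖ + K * ‖testToL2 χ‖ := by linarith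
    have h4 := mul_le_mul_of_nonneg_left h3 (by positivity : 0 ≤ 2 / c)
    have h5 : 2 / c * (c / 2 * ‖testToL2 (covLaplacian β χ)‖) =
        ‖testToL2 (covLaplacian β χ)‖ := by field_simp
    rw [h5] at h4
    linarith
  · refine cauchySeq_of_norm_le (J := testToL2) (K := testToL2 ∘ₗ covLaplacian β)
      (c₁ := c + c / 2) (c₂ := K) (by positivity) hK (fun χ => ?_) hφ.cauchySeq h
    have h1 := norm_sub_norm_le (hamiltonianOnTest m ħ κ A V hA hV χ)
      ((c : ℂ) • testToL2 (covLaplacian β χ))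
    rw [hnorm] at h1
    have h2 := hKφ χ
    change _ ≤ (c + c / 2) * ‖testToL2 (covLaplacian β χ)‖ + _
    linarith

/-! ### Application to the Bloch and Bloch–Landau Hamiltonians -/

lemma IsCb.exists_bound {n : ℕ∞} (hn : 1 ≤ n) {f : Plane → ℝ} (hf : IsCb n f) :
    ∃ C, 0 ≤ C ∧ (∀ x, |f x| ≤ C) ∧ ∀ x, ‖fderiv ℝ f x‖ ≤ C := by
  obtain ⟨C₀, h₀⟩ := hf.2 0 (by simp)
  obtain ⟨C₁, h₁⟩ := hf.2 1 (by exact_mod_cast hn)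
  refine ⟨max (max C₀ C₁) 0, le_max_right _ _, fun x => ?_, fun x => ?_⟩
  · have := h₀ x
    rw [norm_iteratedFDeriv_zero, Real.norm_eq_abs] at this
    exact this.trans ((le_max_left _ _).trans (le_max_left _ _))
  · have := h₁ x
    rw [norm_iteratedFDeriv_one] at this
    exact this.trans ((le_max_right _ _).trans (le_max_left _ _))

end BlochLandau

open BlochLandau in
theorem proposition2p1 (m ħ q c B : ℝ) (hm : 0 < m) (hħ : 0 < ħ) (hc : 0 < c)
    (a b : Plane) (hab : 0 < wedge a b)
    (AΓ A₀ : Plane → Plane) (VΓ Φ : Plane → ℝ)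
    (hΓ : InternalWeak a b AΓ VΓ) (hE : External A₀ Φ) :
    IsEssentiallySelfAdjoint (blochLandauHamiltonian m ħ q c B hab hΓ hE) ∧
    IsEssentiallySelfAdjoint (periodicHamiltonian m ħ q c hab hΓ) ∧
    (periodicHamiltonian m ħ q c hab hΓ).closure.domain = sobolevTwo ∧
    (blochLandauHamiltonian m ħ q c B hab hΓ hE).closure.domain =
      magneticSobolevTwo (q * B / (c * ħ)) := by
  have hVl := isLocallyL2_of_periodic hab hΓ.periodic_V hΓ.memLp_V
  have hVu := isUniformlyLocallyL2_of_periodic hab hΓ.periodic_V hVl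
  have hAΓ (j : Fin 2) : ContDiff ℝ 1 fun r => AΓ r j := by exact_mod_cast (hΓ.cb_A j).1
  have hA₀ (j : Fin 2) : ContDiff ℝ 1 fun r => A₀ r j :=
    (hE.cb_A j).1.of_le (by exact_mod_cast le_top)
  choose C hC0 hC hC' using fun j => (hΓ.cb_A j).exists_bound le_rfl
  choose D hD0 hD hD' using fun j => (hE.cb_A j).exists_bound le_top
  obtain ⟨F, -, hF, -⟩ := hE.cb_Φ.exists_bound le_top
  have hCs (j : Fin 2) : C j ≤ C 0 + C 1 := by
    fin_cases j
    · exact le_add_of_nonneg_right (hC0 1)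
    · exact le_add_of_nonneg_left (hC0 0)
  have hDs (j : Fin 2) : D j ≤ D 0 + D 1 := by
    fin_cases j
    · exact le_add_of_nonneg_right (hD0 1)
    · exact le_add_of_nonneg_left (hD0 0)
  -- Without a uniform field the whole potential `(q/c) A_Γ` counts as the bounded perturbation.
  have hper := schrodinger_essentiallySelfAdjoint (κ := q / c) (β := 0) hm hħ hAΓ hVl hVu
    (a := fun j r => q / c * AΓ r j) (M := |q / c| * (C 0 + C 1))
    (fun j r => by fin_cases j <;> simp [uniformPotential])
    (fun j => contDiff_const.mul (hAΓ j))
    (fun j r => by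
      rw [abs_mul]
      gcongr
      exact (hC j r).trans (hCs j))
    (fun j r => by
      rw [fderiv_const_mul ((hAΓ j).differentiable (by simp) r), norm_smul, Real.norm_eq_abs]
      gcongr
      exact (hC' j r).trans (hCs j))
  have hΦ : IsUniformlyLocallyL2 fun r => q * Φ r :=
    isUniformlyLocallyL2_of_bounded (C := |q| * F) fun x => by
      rw [norm_mul, Real.norm_eq_abs, Real.norm_eq_abs]
      gcongr
      exact hF x
  have hΦc : Continuous fun r => q * Φ r := continuous_const.mul hE.cb_Φ.1.continuous
  -- This `β` is the one with `(q/c) A_B = ħ A_β`, so the unbounded part of the potential goes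
  -- entirely into the model operator.
  have hBL := schrodinger_essentiallySelfAdjoint (κ := q / c) (β := q * B / (c * ħ)) hm hħ
    (contDiff_total B hΓ hE) (hVl.add (isLocallyL2_of_continuous hΦc))
    (hVu.add hΦ hVl.aestronglyMeasurable hΦc.aestronglyMeasurable)
    (a := fun j r => q / c * (AΓ r j + A₀ r j)) (M := |q / c| * ((C 0 + C 1) + (D 0 + D 1)))
    (fun j r => by
      fin_cases j <;> simp [uniformPotential] <;> field_simp <;> ring)
    (fun j => contDiff_const.mul ((hAΓ j).add (hA₀ j)))
    (fun j r => by
      rw [abs_mul]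
      gcongr
      exact (abs_add_le _ _).trans (add_le_add ((hC j r).trans (hCs j)) ((hD j r).trans (hDs j))))
    (fun j r => by
      have d1 := (hAΓ j).differentiable (by simp) r
      have d2 := (hA₀ j).differentiable (by simp) r
      rw [fderiv_const_mul (d1.fun_add d2), fderiv_fun_add d1 d2, norm_smul, Real.norm_eq_abs]
      gcongr
      exact (norm_add_le _ _).trans
        (add_le_add ((hC' j r).trans (hCs j)) ((hD' j r).trans (hDs j))))
  refine ⟨hBL.1, hper.1, ?_, hBL.2⟩
  rw [sobolevTwo, ← magneticD_zero]
  exact hper.2
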